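/- **Definitions.** Let $G$ be a finite planar map (a finite connected graph embedded in the plane) and let $x_0,x_1,x_2$ be three distinct vertices occurring in counterclockwise order on its outer face. The *suspension* $G^\sigma$ is obtained by attaching to each $x_i$ a half-edge reaching into the outer face. Consider orientations and colorings of the edges with colors $0,1,2\in\mathbb Z/3$ in which every edge is oriented in one direction, or in two opposite directions of distinct colors. A vertex $v$ has the *Schnyder property* if it has exactly one outgoing edge $e_i(v)$ of each color $i$, the edges $e_0(v),e_1(v),e_2(v)$ occur in counterclockwise order, and every edge entering $v$ in color $i$ enters in the (closed) counterclockwise sector from $e_{i+1}(v)$ to $e_{i-1}(v)$. An *$i$-cycle* is a directed cycle with all edges directed in color $i$ along it. A *planar Schnyder wood* of $G$ rooted at $x_0,x_1,x_2$ is such an orientation and coloring of $G^\sigma$ in which every vertex has the Schnyder property, the half-edge at $x_i$ is directed outwards with color $i$, and there is no monochromatic cycle. A *toroidal Schnyder wood* of a map on the torus is such an orientation and coloring in which every vertex has the Schnyder property and every $i$-cycle shares a vertex with at least one $(i-1)$-cycle and with at least one $(i+1)$-cycle. The map $G^+$ on the torus is obtained from $G^\sigma$ by adding a vertex $v$ in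 the outer face, with three pairwise non-homotopic non-contractible loops, and connecting the half-edge at $x_i$ to $v$ for $i=0,1,2$ so that no two of the three edges $x_iv$ are consecutive around $v$. Each of the six ends of loops at $v$ thus comes either just before or just after one of the edges $x_iv$ in counterclockwise order around $v$, and each loop has one end of each kind. **Theorem.** $G^+$ is a map on the torus, and the planar Schnyder woods of $G$ rooted at $x_0,x_1,x_2$ are in bijection with the toroidal Schnyder woods of $G^+$, where two toroidal Schnyder woods are identified if they agree on all edges other than the three loops up to a cyclic permutation of the colors. The bijection is given by restriction: a planar Schnyder wood $S$ corresponds to the class of those toroidal Schnyder woods $T$ for which there is $k\in\mathbb Z/3$ such that on $G$ and on the edges $x_iv$ (directed out of $x_i$) the wood $T$ is obtained from $S$ by adding $k$ to all colors. Moreover, in every toroidal Schnyder wood of $G^+$ each loop is oriented in one direction only, and either all three loops leave $v$ through their ends that come just before an edge $x_iv$, or all three leave $v$ through their ends that come just after one. For every planar Schnyder wood $S$, every $k\in\mathbb Z/3$ and each of these two choices there is exactly one toroidal Schnyder wood $T$ of $G^+$ that restricts to $S$ with shift $k$ and has the loops directed according to the choice. -/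

import Mathlib

/-- A combinatorial map (rotation system) on an oriented surface, possibly with half-edges.
The elements of `D` are the darts (edges with a chosen end, thought of as leaving that end).
`rot d` is the next dart after `d` in counterclockwise order around the origin of `d`, and
`opp d` is the same edge seen from its other end. A fixed point of `opp` is a half-edge, that is,
an edge with only one end. -/
structure CMap (D : Type*) where
  rot : Equiv.Perm D
  opp : Equiv.Perm D
  opp_opp : ∀ d, opp (opp d) = d

namespace CMap

variable {D : Type*} (M : CMap D)

/-- Two darts leave the same vertex. The vertices are the cycles of `rot`. -/
def SameVertex (d e : D) : Prop := M.rot.SameCycle d e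

/-- The face permutation. Its cycles are the faces: `face d` is the dart that follows `d` on the
boundary of the face to the left of `d`, when walking with that face on the left. The corner
between `d` and `rot d` belongs to the face to the left of `d`. -/
def face : Equiv.Perm D := M.rot⁻¹ * M.opp

def Vertices : Type _ := Quotient (Equiv.Perm.SameCycle.setoid M.rot)

def Edges : Type _ := Quotient (Equiv.Perm.SameCycle.setoid M.opp)

def Faces : Type _ := Quotient (Equiv.Perm.SameCycle.setoid M.face)

def Connected : Prop :=
  ∀ x y : D, ∃ g ∈ Subgroup.closure ({M.rot, M.opp} : Set (Equiv.Perm D)), g x = y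

/-- The Euler characteristic `n - m + f`. -/
noncomputable def eulerChar : ℤ :=
  (Nat.card M.Vertices : ℤ) - Nat.card M.Edges + Nat.card M.Faces

/-- A (finite, connected) map without half-edges on the closed oriented surface of genus `g`,
all of whose faces are open disks. -/
def IsMapOfGenus (g : ℕ) : Prop :=
  (∀ d, M.opp d ≠ d) ∧ M.Connected ∧ M.eulerChar = 2 - 2 * (g : ℤ)

/-- `y` lies in the closed counterclockwise sector from `x` to `z`: turning counterclockwise
from `x` one meets `y` no later than the first meeting with `z`. -/
def InSector (x z y : D) : Prop :=
  ∃ k n : ℕ, k ≤ n ∧ (M.rot ^ k) x = y ∧ (M.rot ^ n) x = z ∧ ∀ j < n, (M.rot ^ j) x ≠ z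

/-- `col d = some i` means that the edge of `d` is directed away from the origin of `d` in
color `i`, and `col d = none` means that it is not directed away from the origin of `d`.
The condition says that every edge is oriented in one direction or in two opposite directions,
the two directions having distinct colors. -/
def IsOrientedColoring (col : D → Option (ZMod 3)) : Prop :=
  ∀ d, (col d ≠ none ∨ col (M.opp d) ≠ none) ∧
    (M.opp d ≠ d → col d ≠ none → col d ≠ col (M.opp d))

/-- The edge of `d` enters the origin of `d` in color `i`. -/
def Enters (col : D → Option (ZMod 3)) (d : D) (i : ZMod 3) : Prop :=
  M.opp d ≠ d ∧ col (M.opp d) = some i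

/-- The Schnyder property at the origin `v` of the dart `x`: `v` has exactly one outgoing edge
`e i` in each color `i`, the edges `e 0`, `e 1`, `e 2` occur in counterclockwise order around `v`,
and each edge entering `v` in color `i` does so in the counterclockwise sector from
`e (i + 1)` to `e (i - 1)`. -/
def SchnyderAt (col : D → Option (ZMod 3)) (x : D) : Prop :=
  ∃ e : ZMod 3 → D,
    (∀ i, M.SameVertex x (e i) ∧ col (e i) = some i) ∧
    (∀ i d, M.SameVertex x d → col d = some i → d = e i) ∧
    M.InSector (e 0) (e 2) (e 1) ∧
    (∀ i d, M.SameVertex x d → M.Enters col d i → M.InSector (e (i + 1)) (e (i - 1)) d)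

/-- `c 0, …, c n` are the consecutive edges of a directed cycle of length `n + 1`, all of whose
edges are directed in color `i` along the cycle; the vertices of the cycle are distinct.
(Addition in `Fin (n + 1)` is modulo `n + 1`.) -/
def IsMonoCycle (col : D → Option (ZMod 3)) (i : ZMod 3) {n : ℕ} (c : Fin (n + 1) → D) : Prop :=
  (∀ k, M.opp (c k) ≠ c k ∧ col (c k) = some i ∧ M.SameVertex (M.opp (c k)) (c (k + 1))) ∧
    ∀ k l, M.SameVertex (c k) (c l) → k = l

/-- Every cycle of color `i` has a vertex in common with some cycle of color `j`. -/
def CyclesMeet (col : D → Option (ZMod 3)) (i j : ZMod 3) : Prop :=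
  ∀ (n : ℕ) (c : Fin (n + 1) → D), M.IsMonoCycle col i c →
    ∃ (m : ℕ) (c' : Fin (m + 1) → D), M.IsMonoCycle col j c' ∧
      ∃ k l, M.SameVertex (c k) (c' l)

/-- Schnyder woods of a map on the torus. -/
def IsToroidalWood (col : D → Option (ZMod 3)) : Prop :=
  M.IsOrientedColoring col ∧ (∀ x, M.SchnyderAt col x) ∧
    ∀ i, M.CyclesMeet col i (i - 1) ∧ M.CyclesMeet col i (i + 1)

end CMap

/-- A planar map (genus `0`, with the outer face chosen to be the face of the corners below), with
three corners of the outer face at three distinct vertices `x 0`, `x 1`, `x 2`, occurring in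
counterclockwise order on the outer face. `corner i` stands for the angle at `x i` between the dart
`corner i` and the dart following it counterclockwise around `x i`. As `face` walks around
the outer face with that face on the left, i.e. clockwise around the map, the counterclockwise
order is the order given by `face⁻¹`. -/
structure RootedPlanarMap (D : Type*) extends CMap D where
  genus_zero : toCMap.IsMapOfGenus 0
  corner : ZMod 3 → D
  distinct_vertices : ∀ i j, toCMap.SameVertex (corner i) (corner j) → i = j
  ccw_on_outer_face : ∃ a b : ℕ, 0 < a ∧ a < b ∧
    b < Function.minimalPeriod toCMap.face (corner 0) ∧
    (toCMap.face⁻¹ ^ a) (corner 0) = corner 1 ∧ (toCMap.face⁻¹ ^ b) (corner 0) = corner 2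

/-- The darts at the additional vertex `v` of the toroidal map: `spoke i` is the edge
joining `v` to the root `x i`; `pre i` and `post i` are the loop darts just before and just
after `spoke i` in counterclockwise order around `v`. -/
inductive VDart : Type
  | spoke (i : ZMod 3)
  | pre (i : ZMod 3)
  | post (i : ZMod 3)

namespace VDart

/-- The counterclockwise order around `v` is
`pre 0, spoke 0, post 0, pre 1, spoke 1, post 1, pre 2, spoke 2, post 2`. -/
def rot : Equiv.Perm VDart where
  toFun
    | pre i => spoke i
    | spoke i => post i
    | post i => pre (i + 1)
  invFun
    | spoke i => pre i
    | post i => spoke i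
    | pre i => post (i - 1)
  left_inv := by rintro (i | i | i) <;> simp
  right_inv := by rintro (i | i | i) <;> simp

end VDart

namespace RootedPlanarMap

variable {D : Type*} (G : RootedPlanarMap D)

open Classical in
/-- The suspension: a half-edge `Sum.inr i` is attached to `x i` in the outer face, between
`corner i` and the dart following it: the rotation sends `corner i` to the new half-edge, the new
half-edge to `rot (corner i)`, and it is otherwise unchanged. -/
noncomputable def suspension : CMap (D ⊕ ZMod 3) where
  rot := Equiv.sumCongr G.rot 1 *
    (Equiv.swap (Sum.inl (G.corner 0)) (Sum.inr 0) *
      Equiv.swap (Sum.inl (G.corner 1)) (Sum.inr 1) *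
      Equiv.swap (Sum.inl (G.corner 2)) (Sum.inr 2))
  opp := Equiv.sumCongr G.opp 1
  opp_opp := by rintro (d | i) <;> simp [G.opp_opp]

/-- The involution of the darts of the toroidal map: the edges of the planar map are kept, the
half-edge at `x i` becomes an edge from `x i` to `v`, and the three loops at `v`
are `{pre i, post (i + 1)}`. -/
def plusOpp : (D ⊕ ZMod 3) ⊕ VDart → (D ⊕ ZMod 3) ⊕ VDart
  | Sum.inl (Sum.inl d) => Sum.inl (Sum.inl (G.opp d))
  | Sum.inl (Sum.inr i) => Sum.inr (VDart.spoke i)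
  | Sum.inr (VDart.spoke i) => Sum.inl (Sum.inr i)
  | Sum.inr (VDart.pre i) => Sum.inr (VDart.post (i + 1))
  | Sum.inr (VDart.post i) => Sum.inr (VDart.pre (i - 1))

theorem plusOpp_plusOpp : Function.Involutive G.plusOpp := by
  rintro ((d | i) | (i | i | i)) <;> simp [plusOpp, G.opp_opp]

/-- The toroidal map: a vertex `v` with three loops is added to the suspension, and the three
half-edges are connected to `v`, no two of them being consecutive around `v`. -/
noncomputable def plus : CMap ((D ⊕ ZMod 3) ⊕ VDart) where
  rot := Equiv.sumCongr G.suspension.rot VDart.rot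
  opp := G.plusOpp_plusOpp.toPerm
  opp_opp := G.plusOpp_plusOpp

/-- Planar Schnyder woods of `G` rooted at `x 0`, `x 1`, `x 2`, as orientations and colorings of
the suspension. -/
def IsPlanarWood (col : D ⊕ ZMod 3 → Option (ZMod 3)) : Prop :=
  G.suspension.IsOrientedColoring col ∧
    (∀ x, G.suspension.SchnyderAt col x) ∧ (∀ i, col (Sum.inr i) = some i) ∧
    ∀ (i : ZMod 3) (n : ℕ) (c : Fin (n + 1) → D ⊕ ZMod 3), ¬ G.suspension.IsMonoCycle col i c

def PlanarWood : Type _ := {col : D ⊕ ZMod 3 → Option (ZMod 3) // G.IsPlanarWood col}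

def ToroidalWood : Type _ :=
  {col : (D ⊕ ZMod 3) ⊕ VDart → Option (ZMod 3) // G.plus.IsToroidalWood col}

/-- On the edges of `G` and on the edges between the `x i` and `v` (seen from `x i`), the
wood `T` is obtained from `S` by adding `k` to all colors. -/
def Extends (T : G.ToroidalWood) (k : ZMod 3) (S : G.PlanarWood) : Prop :=
  ∀ d : D ⊕ ZMod 3, T.1 (Sum.inl d) = (S.1 d).map (· + k)

/-- Each loop at `v` is directed in one direction only, and all three loops leave `v`
through the darts `pre i` (if `o = true`), or all three through the darts `post i`
(if `o = false`). -/
def LoopsDirected (T : G.ToroidalWood) : (o : Bool) → Prop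
  | true => ∀ i, T.1 (Sum.inr (VDart.pre i)) ≠ none ∧ T.1 (Sum.inr (VDart.post i)) = none
  | false => ∀ i, T.1 (Sum.inr (VDart.pre i)) = none ∧ T.1 (Sum.inr (VDart.post i)) ≠ none

/-- Two Schnyder woods of the toroidal map are identified when they agree outside the three loops,
up to a cyclic permutation of the three colors. -/
def similar : Setoid G.ToroidalWood where
  r T T' := ∃ k : ZMod 3, ∀ d : D ⊕ ZMod 3, T'.1 (Sum.inl d) = (T.1 (Sum.inl d)).map (· + k)
  iseqv :=
    { refl := fun T => ⟨0, fun d => by simp⟩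
      symm := by
        rintro T T' ⟨k, h⟩
        refine ⟨-k, fun d => ?_⟩
        rw [h d, Option.map_map]
        cases T.1 (Sum.inl d) <;> simp
      trans := by
        rintro T T' T'' ⟨k, h⟩ ⟨l, h'⟩
        refine ⟨k + l, fun d => ?_⟩
        rw [h' d, h d, Option.map_map]
        cases T.1 (Sum.inl d) <;> simp }

end RootedPlanarMap

/-!
Both kinds of Schnyder woods are studied through a labeling of the corners by colors: the corners
between the outgoing edges of colors `i + 1` and `i - 1` at a vertex get the label `i`
(`CMap.exists_isLabeling`). Going counterclockwise around a vertex, the label increases by one at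
each outgoing edge. Going along one side of an edge, it increases by zero or one (the change along
that side), and for every edge the two changes and the number of its directions add up to three
(`CMap.IsLabeling.change_add`). Along a face the changes add up to a multiple of three.

In a toroidal Schnyder wood no face is without a change: its boundary would be a monochromatic cycle
that meets no cycle of the preceding color (`CMap.IsToroidalWood.exists_change_ne_zero`). So there
are at least three changes along each inner face of `G`. Summing over the edges of `G`, whose `n`
vertices have `3n` outgoing edges in `G⁺`, at most three of them along the half-edges, Euler's
formula `n - m + f = 2` leaves no slack: all half-edges leave `G`, there are
exactly three changes along each inner face and none along the darts of the outer face
(`RootedPlanarMap.IsToroidalWood.changes`). The three edges `xᵢv` and the three loops then have six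
directions in all, three leaving the `xᵢ` and three leaving `v`, and hence twelve changes; this is
the largest possible number, so each of these edges has a change on both sides and a single
direction. Following the labels around `v` and across the faces at `v` determines all
directions and colors there up to a shift and the choice of one direction of the loops
(`RootedPlanarMap.IsToroidalWood.colors`).

It remains to see that the restriction to `G` has no monochromatic cycle. A simple cycle in a planar
map separates the faces (`CMap.IsSimpleCycle.exists_separation`). Consider the side that contains
the outer face. As it is connected, the number of its faces and inner vertices exceeds that
of its inner edges by at most one (`CMap.IsSimpleCycle.numOrbits_side_le`). If the cycle were
monochromatic, counting outgoing edges and changes of label on this side would give an excess of two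
(`RootedPlanarMap.IsToroidalWood.count_side`). Both the separation and the bound on the excess
come from one inequality of Euler type, `CMap.numOrbits_add_le`, which is proved by linear algebra:
differences of functions on the faces are orthogonal to differences of functions on the vertices.

Conversely, a planar Schnyder wood is extended to `G⁺` by an explicit formula
(`RootedPlanarMap.extendColoring`). Every monochromatic cycle of the extension passes through `v`,
because the planar wood has none, and at `v` there is a loop of every color; so all
monochromatic cycles meet.

That `G⁺` is a map on the torus follows by counting: relative to `G` it has one more vertex, six
more edges and three more faces (`RootedPlanarMap.plus_isMapOfGenus_one`).
-/

/-! ### Invariant functions and orbits of permutations -/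

namespace Equiv.Perm

variable {α β : Type*} {σ : Equiv.Perm α}

theorem SameCycle.eq_of_invariant {f : α → β} (hf : ∀ x, f (σ x) = f x) {x y : α}
    (h : σ.SameCycle x y) : f x = f y := by
  obtain ⟨n, rfl⟩ := h
  have hinv : ∀ x, f (σ⁻¹ x) = f x := fun x => by
    rw [← hf (σ⁻¹ x), ← mul_apply, mul_inv_cancel, one_apply]
  induction n with
  | zero => simp
  | succ n ih => rw [zpow_add_one, (Commute.refl σ).zpow_left n |>.eq, mul_apply, hf, ih]
  | pred n ih =>
    rw [zpow_sub_one, ((Commute.refl σ).inv_right.zpow_left _).eq, mul_apply, hinv, ih]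

theorem SameCycle.iff_of_invariant {p : α → Prop} (hp : ∀ x, p (σ x) ↔ p x) {x y : α}
    (h : σ.SameCycle x y) : p x ↔ p y :=
  iff_of_eq (h.eq_of_invariant fun x => propext (hp x))

/-- The orbit (cycle) of a point. -/
def orbit (σ : Equiv.Perm α) (x : α) : Quotient (SameCycle.setoid σ) := Quotient.mk _ x

theorem orbit_eq_orbit {x y : α} : σ.orbit x = σ.orbit y ↔ σ.SameCycle x y := by
  rw [orbit, orbit, Quotient.eq]; rfl

theorem orbit_apply (x : α) : σ.orbit (σ x) = σ.orbit x :=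
  orbit_eq_orbit.2 (sameCycle_apply_left.2 (SameCycle.refl σ x))

theorem exists_orbit (q : Quotient (SameCycle.setoid σ)) : ∃ x, σ.orbit x = q :=
  Quotient.exists_rep q

theorem SameCycle.exists_natPow [Finite α] {x y : α} (h : σ.SameCycle x y) :
    ∃ n : ℕ, (σ ^ n) x = y := by
  obtain ⟨n, -, h⟩ := h.exists_pow_eq'
  exact ⟨n, h⟩

theorem sameCycle_of_natPow {x y : α} (n : ℕ) (h : (σ ^ n) x = y) : σ.SameCycle x y :=
  ⟨n, by simpa using h⟩

end Equiv.Perm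

/-! ### Cyclic order around a vertex -/

namespace CMap

open Equiv.Perm

variable {D : Type*} (M : CMap D)

theorem face_apply (d : D) : M.face d = M.rot⁻¹ (M.opp d) := rfl

theorem rot_face (d : D) : M.rot (M.face d) = M.opp d := by simp [face_apply]

theorem face_opp (d : D) : M.face (M.opp d) = M.rot⁻¹ d := by simp [face_apply, M.opp_opp]

theorem face_opp_rot (d : D) : M.face (M.opp (M.rot d)) = d := by simp [face_opp]

theorem sameVertex_opp_face (d : D) : M.SameVertex (M.opp d) (M.face d) := by
  rw [← M.rot_face d]
  exact sameCycle_apply_left.2 (SameCycle.refl _ _)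

/-- The relation "`y` comes between `x` and `z`" is invariant under cyclic shifts. -/
theorem InSector.cyclic [Finite D] {x z y : D} (h : M.InSector x z y) (hxy : x ≠ y) :
    M.InSector y x z := by
  classical
  obtain ⟨k, n, hkn, h1, h2, h3⟩ := h
  have hex : ∃ m : ℕ, (M.rot ^ m) y = x :=
    SameCycle.exists_natPow (sameCycle_of_natPow k h1).symm
  refine ⟨n - k, Nat.find hex, ?_, ?_, Nat.find_spec hex, fun j hj => Nat.find_min hex hj⟩
  · by_contra! hlt
    have hm := Nat.find_spec hex
    set m := Nat.find hex
    have hx : (M.rot ^ (k + m)) x = x := by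
      rw [add_comm, pow_add, mul_apply, h1, hm]
    have hpos : 0 < k + m := by
      rcases Nat.eq_zero_or_pos k with rfl | hk
      · exact absurd h1 (by simpa using hxy)
      · omega
    refine h3 (n - (k + m)) (by omega) ?_
    rw [← h2]
    conv_rhs => rw [show n = (n - (k + m)) + (k + m) by omega, pow_add, mul_apply, hx]
  · rw [← h1, ← h2, ← mul_apply, ← pow_add, Nat.sub_add_cancel hkn]

/-- The three outgoing edges at a vertex with the Schnyder property, with the cyclic order stated
symmetrically in the colors. -/
theorem SchnyderAt.exists_cyclic [Finite D] {col : D → Option (ZMod 3)} {x : D}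
    (h : M.SchnyderAt col x) :
    ∃ e : ZMod 3 → D, (∀ i, M.SameVertex x (e i) ∧ col (e i) = some i) ∧
      (∀ i d, M.SameVertex x d → col d = some i → d = e i) ∧
      (∀ i, M.InSector (e i) (e (i + 2)) (e (i + 1))) ∧
      (∀ i d, M.SameVertex x d → M.Enters col d i → M.InSector (e (i + 1)) (e (i - 1)) d) := by
  obtain ⟨e, h1, h2, h3, h4⟩ := h
  have hne : ∀ i j, i ≠ j → e i ≠ e j := fun i j hij he => hij (by
    have := (h1 i).2
    rw [he, (h1 j).2] at this
    exact (Option.some.inj this).symm)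
  have h5 : M.InSector (e 1) (e 0) (e 2) := InSector.cyclic M h3 (hne _ _ (by decide))
  have h6 : M.InSector (e 2) (e 1) (e 0) := InSector.cyclic M h5 (hne _ _ (by decide))
  refine ⟨e, h1, h2, fun i => ?_, h4⟩
  fin_cases i
  · exact h3
  · exact h5
  · exact h6

/-- Adding a constant to all colors preserves the Schnyder property. -/
theorem SchnyderAt.shift [Finite D] {col : D → Option (ZMod 3)} {x : D}
    (h : M.SchnyderAt col x) (k : ZMod 3) :
    M.SchnyderAt (fun d => (col d).map (· + k)) x := by
  obtain ⟨e, h1, h2, h3, h4⟩ := SchnyderAt.exists_cyclic M h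
  refine ⟨fun i => e (i - k), fun i => ⟨(h1 _).1, by simp [(h1 (i - k)).2]⟩, ?_, ?_, ?_⟩
  · intro i d hd hc
    obtain ⟨j, hj, rfl⟩ := Option.map_eq_some_iff.1 hc
    exact h2 _ d hd (by simpa using hj)
  · have := h3 (0 - k)
    rwa [show (0 - k + 2 : ZMod 3) = 2 - k by ring, show (0 - k + 1 : ZMod 3) = 1 - k by ring]
      at this
  · rintro i d hd ⟨hd1, hd2⟩
    obtain ⟨j, hj, rfl⟩ := Option.map_eq_some_iff.1 hd2
    have := h4 j d hd ⟨hd1, hj⟩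
    rwa [show j + 1 = j + k + 1 - k by ring, show j - 1 = j + k - 1 - k by ring] at this

/-! ### Labels of corners -/

/-- A labeling of the corners by colors, `ℓ d` being the label of the corner following `d`
counterclockwise. The corners of the sector from the outgoing edge of color `i + 1` to that of
color `i - 1` have the label `i`; the label therefore increases by one at every outgoing edge and
is unchanged at the other edges. -/
structure IsLabeling (col : D → Option (ZMod 3)) (ℓ : D → ZMod 3) : Prop where
  rot_of_none : ∀ d, col (M.rot d) = none → ℓ (M.rot d) = ℓ d
  rot_of_some : ∀ d i, col (M.rot d) = some i → ℓ d = i + 1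
  of_out : ∀ d i, col d = some i → ℓ d = i - 1
  of_enters : ∀ d i, M.Enters col d i → col d = none → ℓ d = i
  prev : ∀ d, ∃ n : ℕ, col ((M.rot⁻¹ ^ n) d) = some (ℓ d + 1) ∧
    ∀ j < n, col ((M.rot⁻¹ ^ j) d) = none

theorem inv_pow_rot_pow {n k : ℕ} (h : n ≤ k) (d : D) :
    (M.rot⁻¹ ^ n) ((M.rot ^ k) d) = (M.rot ^ (k - n)) d := by
  rw [inv_pow, Equiv.Perm.inv_eq_iff_eq, ← mul_apply, ← pow_add, Nat.add_sub_cancel' h]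

theorem exists_isLabeling [Finite D] {col : D → Option (ZMod 3)} (h : ∀ x, M.SchnyderAt col x) :
    ∃ ℓ, M.IsLabeling col ℓ := by
  classical
  -- The label of `d` is determined by the last outgoing edge before the corner of `d`.
  have hprev : ∀ d, ∃ (n : ℕ) (i : ZMod 3), col ((M.rot⁻¹ ^ n) d) = some i ∧
      ∀ j < n, col ((M.rot⁻¹ ^ j) d) = none := by
    intro d
    have hex : ∃ n : ℕ, col ((M.rot⁻¹ ^ n) d) ≠ none := by
      obtain ⟨e, h1, -⟩ := h d
      obtain ⟨n, hn⟩ := SameCycle.exists_natPow (σ := M.rot⁻¹) (sameCycle_inv.2 (h1 0).1)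
      exact ⟨n, by rw [hn, (h1 0).2]; simp⟩
    obtain ⟨i, hi⟩ := Option.ne_none_iff_exists'.1 (Nat.find_spec hex)
    exact ⟨Nat.find hex, i, hi, fun j hj => not_not.1 (Nat.find_min hex hj)⟩
  choose N c hc hN using hprev
  have huniq : ∀ d n i, col ((M.rot⁻¹ ^ n) d) = some i →
      (∀ j < n, col ((M.rot⁻¹ ^ j) d) = none) → c d = i := by
    intro d n i h1 h2
    have : N d = n := by
      rcases lt_trichotomy (N d) n with hlt | heq | hlt
      · exact absurd (h2 _ hlt) (by rw [hc d]; simp)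
      · exact heq
      · exact absurd (hN d _ hlt) (by rw [h1]; simp)
    have h3 := hc d
    rw [this, h1] at h3
    exact (Option.some.inj h3).symm
  refine ⟨fun d => c d - 1, ?_, ?_, ?_, ?_, ?_⟩
  · intro d hd
    have : c (M.rot d) = c d := by
      refine huniq _ (N d + 1) _ ?_ ?_
      · rw [pow_succ, mul_apply, ← mul_apply _ M.rot, inv_mul_cancel, one_apply]; exact hc d
      · rintro (_ | j) hj
        · exact hd
        · rw [pow_succ, mul_apply, ← mul_apply _ M.rot, inv_mul_cancel, one_apply]
          exact hN d j (by omega)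
    simp [this]
  · -- The previous outgoing edge has color `j`; as the outgoing edges of colors `j`, `j + 1`, `j + 2`
    -- occur in this order, the next one cannot have color `j + 2`, nor color `j`.
    intro d i hd
    obtain ⟨e, h1, h2, h3, h4⟩ := SchnyderAt.exists_cyclic M (h d)
    set j := c d with hj
    have hej : (M.rot⁻¹ ^ N d) d = e j :=
      h2 j _ ((sameCycle_inv.1 (sameCycle_of_natPow (N d) rfl))) (hc d)
    have hei : M.rot d = e i :=
      h2 i _ (sameCycle_apply_right.2 (SameCycle.refl _ _)) hd
    have hstep : ∀ m, m ≤ N d → (M.rot ^ m) (e j) = (M.rot⁻¹ ^ (N d - m)) d := by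
      intro m hm
      rw [← hej, inv_pow, inv_pow, Equiv.Perm.eq_inv_iff_eq, ← mul_apply, ← pow_add,
        Nat.sub_add_cancel hm, ← mul_apply, mul_inv_cancel, one_apply]
    have hlast : (M.rot ^ (N d + 1)) (e j) = e i := by
      rw [pow_succ', mul_apply, hstep _ le_rfl]; simpa using hei
    obtain ⟨k, n, hkn, hk, hn, hlt⟩ := h3 j
    have hcne : ∀ a b, e a = e b → a = b := fun a b hab => by
      have := (h1 a).2
      rw [hab, (h1 b).2] at this
      exact (Option.some.inj this).symm
    have hk0 : N d + 1 ≤ k := by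
      by_contra! hlt'
      have h5 := hstep k (by omega)
      rcases Nat.eq_zero_or_pos k with rfl | hkpos
      · exact absurd (hcne _ _ hk) (by simp)
      · have h6 := hN d (N d - k) (by omega)
        rw [← h5, hk, (h1 _).2] at h6
        simp at h6
    have hij : i = j + 1 ∨ i = j + 2 ∨ i = j := by
      generalize j = j'
      clear * -; revert i j'; decide
    rcases hij with hij | hij | hij
    · rw [hij]
      generalize j = j'
      clear * -; revert j'; decide
    · have : N d + 1 = n := by
        by_contra hne
        exact hlt (N d + 1) (by omega) (by rw [hlast, hij])
      have h5 : k = n := by omega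
      rw [h5, hn] at hk
      exact absurd (hcne _ _ hk) (by simp; decide)
    · exfalso
      rw [hij] at hlast
      refine hlt (n - (N d + 1)) (by omega) ?_
      rw [← hn]
      conv_rhs => rw [show n = (n - (N d + 1)) + (N d + 1) by omega, pow_add, mul_apply, hlast]
  · intro d i hd
    have := huniq d 0 i (by simpa using hd) (by simp)
    simp [this]
  · -- The last outgoing edge before `d` lies in the sector from the outgoing edge of color `i + 1`
    -- to that of color `i - 1`. It is not the end of the sector, and by the cyclic order it does not
    -- have color `i`.
    intro d i hd hnone
    obtain ⟨e, h1, h2, h3, h4⟩ := SchnyderAt.exists_cyclic M (h d)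
    set j := c d with hj
    have hej : (M.rot⁻¹ ^ N d) d = e j :=
      h2 j _ ((sameCycle_inv.1 (sameCycle_of_natPow (N d) rfl))) (hc d)
    obtain ⟨k, n, hkn, hk, hn, hlt⟩ := h4 i d (SameCycle.refl _ _) hd
    have hN0 : N d ≠ 0 := fun h0 => by
      have := hc d
      rw [h0] at this
      simp [hnone] at this
    have hNk : N d ≤ k := by
      by_contra! hlt'
      have h5 := hN d k hlt'
      rw [← hk, M.inv_pow_rot_pow le_rfl] at h5
      simp [(h1 _).2] at h5
    have hat : (M.rot ^ (k - N d)) (e (i + 1)) = e j := by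
      rw [← M.inv_pow_rot_pow hNk, hk, hej]
    obtain ⟨a, b, hab, ha, hb, hltb⟩ := h3 (i + 1)
    have hij : j = i + 1 ∨ j = i - 1 ∨ j = i + 1 + 2 := by
      generalize j = j'
      clear * -; revert i j'; decide
    rcases hij with hij | hij | hij
    · rw [hij]; ring
    · exact absurd (by rw [hat, hij]) (hlt (k - N d) (by omega))
    · have hna : n ≤ a := by
        by_contra! hlt'
        refine hlt a hlt' ?_
        rw [ha]
        congr 1
        clear * -; revert i; decide
      exact absurd (by rw [hat, hij]) (hltb (k - N d) (by omega))
  · intro d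
    exact ⟨N d, by simpa using hc d, hN d⟩

end CMap

/-! ### Changes of label along edges and faces -/

namespace CMap

open Equiv.Perm

variable {D : Type*} (M : CMap D)

theorem SchnyderAt.out_unique {col : D → Option (ZMod 3)} {x y : D} {i : ZMod 3}
    (h : M.SchnyderAt col x) (hx : col x = some i) (hy : col y = some i)
    (hxy : M.SameVertex x y) : x = y := by
  obtain ⟨e, -, h2, -⟩ := h
  rw [h2 i x (SameCycle.refl _ _) hx, h2 i y hxy hy]

/-- The number (`0` or `1`) of directions of the edge of `d` that leave the origin of `d`. -/
def outs (col : D → Option (ZMod 3)) (d : D) : ℕ := (col d).elim 0 fun _ => 1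

theorem outs_le_one (col : D → Option (ZMod 3)) (d : D) : outs col d ≤ 1 := by
  rw [outs]; cases col d <;> simp

theorem outs_of_none {col : D → Option (ZMod 3)} {d : D} (h : col d = none) : outs col d = 0 := by
  simp [outs, h]

theorem outs_of_some {col : D → Option (ZMod 3)} {d : D} {i : ZMod 3} (h : col d = some i) :
    outs col d = 1 := by simp [outs, h]

theorem outs_eq_zero {col : D → Option (ZMod 3)} {d : D} : outs col d = 0 ↔ col d = none := by
  rw [outs]; cases col d <;> simp

/-- The increase of the label along the left side of `d`, from the corner at the origin of `d` to
the next corner of the face on the left of `d`. -/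
def change (ℓ : D → ZMod 3) (d : D) : ℕ := (ℓ (M.face d) - ℓ d).val

theorem label_face (ℓ : D → ZMod 3) (d : D) : ℓ (M.face d) = ℓ d + M.change ℓ d := by
  simp [change]

variable {M} {col : D → Option (ZMod 3)} {ℓ : D → ZMod 3}

theorem IsLabeling.label_rot (h : M.IsLabeling col ℓ) (d : D) :
    ℓ (M.rot d) = ℓ d + outs col (M.rot d) := by
  rcases hc : col (M.rot d) with _ | i
  · simp [h.rot_of_none d hc, outs, hc]
  · rw [h.rot_of_some d i hc, h.of_out _ i hc, outs, hc]
    clear * -; revert i; decide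

theorem IsLabeling.change_spec (h : M.IsLabeling col ℓ) (ho : M.IsOrientedColoring col) {d : D}
    (hd : M.opp d ≠ d) :
    (M.change ℓ d = 1 ∧ (col d = none ∨ col (M.opp d) = none ∨
      ∃ i, col d = some i ∧ col (M.opp d) = some (i + 2))) ∨
    (M.change ℓ d = 0 ∧ ∃ i, col d = some i ∧ col (M.opp d) = some (i + 1)) := by
  have hf := M.rot_face d
  rcases h1 : col d with _ | i <;> rcases h2 : col (M.opp d) with _ | j
  · have := (ho d).1
    simp [h1, h2] at this
  · have h3 := h.of_enters d j ⟨hd, h2⟩ h1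
    have h4 := h.rot_of_some (M.face d) j (by rw [hf, h2])
    left
    simp only [true_or, and_true, change, h3, h4]
    clear * -; revert j; decide
  · have h3 := h.of_out d i h1
    have h4 := h.rot_of_none (M.face d) (by rw [hf, h2])
    have h5 := h.of_enters (M.opp d) i ⟨by rw [M.opp_opp]; exact hd.symm, by rw [M.opp_opp, h1]⟩ h2
    left
    rw [hf] at h4
    simp only [true_or, or_true, and_true, change, h3, ← h4, h5]
    clear * -; revert i; decide
  · have h3 := h.of_out d i h1
    have h4 := h.rot_of_some (M.face d) j (by rw [hf, h2])
    have hij := (ho d).2 hd (by simp [h1])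
    rw [h1, h2] at hij
    simp only [change, h3, h4, Option.some.injEq, reduceCtorEq, false_or]
    simp only [ne_eq, Option.some.injEq] at hij
    clear * - hij; revert i j; decide

theorem IsLabeling.change_le_one (h : M.IsLabeling col ℓ) (ho : M.IsOrientedColoring col) {d : D}
    (hd : M.opp d ≠ d) : M.change ℓ d ≤ 1 := by
  rcases h.change_spec ho hd with h | h <;> omega

/-- Walking around an edge: the changes along its two sides and the number of its directions add
up to three. -/
theorem IsLabeling.change_add (h : M.IsLabeling col ℓ) (ho : M.IsOrientedColoring col) {d : D}
    (hd : M.opp d ≠ d) :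
    M.change ℓ d + M.change ℓ (M.opp d) + (outs col d + outs col (M.opp d)) = 3 := by
  have hd' : M.opp (M.opp d) ≠ M.opp d := by rw [M.opp_opp]; exact hd.symm
  rcases h.change_spec ho hd with ⟨h1, h1'⟩ | ⟨h1, i, hi, hi'⟩ <;>
    rcases h.change_spec ho hd' with ⟨h2, h2'⟩ | ⟨h2, j, hj, hj'⟩ <;>
    rw [h1, h2]
  · rw [M.opp_opp] at h2'
    have := (ho d).1
    rcases h3 : col d with _ | a <;> rcases h4 : col (M.opp d) with _ | b
    · simp [h3, h4] at this
    · simp [outs, h3, h4]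
    · simp [outs, h3, h4]
    · -- a change on both sides of a bidirected edge would need `b = a + 2` and `a = b + 2`
      simp only [h3, h4, reduceCtorEq, Option.some.injEq, false_or, exists_eq_left'] at h1' h2'
      exfalso
      clear * - h1' h2'; revert a b; decide
  · rw [M.opp_opp] at hj'
    simp [outs, hj, hj']
  · simp [outs, hi, hi']
  · rw [M.opp_opp, hi] at hj'
    rw [hi', Option.some.injEq] at hj
    rw [Option.some.injEq] at hj'
    exfalso
    clear * - hj hj'; revert i j; decide

/-- In a toroidal Schnyder wood the label changes somewhere along every face. Otherwise the
boundary of the face would be an `i`-cycle whose reversal is an `(i + 1)`-cycle, and at each of its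
vertices the sector in which edges of color `i - 1` may enter would lie inside the face, so that no
`(i - 1)`-cycle could share a vertex with it. -/
theorem IsToroidalWood.exists_change_ne_zero [Finite D] (hT : M.IsToroidalWood col)
    (hopp : ∀ d, M.opp d ≠ d) (h : M.IsLabeling col ℓ) (d : D) :
    ∃ n : ℕ, M.change ℓ ((M.face ^ n) d) ≠ 0 := by
  by_contra! h0
  obtain ⟨ho, hs, hc⟩ := hT
  have hcol : ∀ n : ℕ, col ((M.face ^ n) d) = some (ℓ d + 1) ∧
      col (M.opp ((M.face ^ n) d)) = some (ℓ d + 2) := by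
    intro n
    have hl : ℓ ((M.face ^ n) d) = ℓ d := by
      induction n with
      | zero => rfl
      | succ n ih => rw [pow_succ', mul_apply, M.label_face ℓ, h0 n, ih]; simp
    rcases h.change_spec ho (hopp ((M.face ^ n) d)) with ⟨h1, -⟩ | ⟨-, i, hi, hi'⟩
    · simp [h0 n] at h1
    · have h3 := h.of_out _ i hi
      rw [hl] at h3
      rw [hi, hi', h3]
      constructor <;> congr 1 <;> ring
  set i := ℓ d + 1 with hi
  obtain ⟨N, hN⟩ : ∃ N, Function.minimalPeriod M.face d = N + 1 :=
    Nat.exists_eq_succ_of_ne_zero (Function.minimalPeriod_pos_of_mem_periodicPts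
      (M.face.injective.mem_periodicPts d)).ne'
  set c : Fin (N + 1) → D := fun k => (M.face ^ (k : ℕ)) d with hcdef
  have hface : ∀ k, M.face (c k) = c (k + 1) := by
    intro k
    simp only [hcdef, ← iterate_eq_pow, ← Function.iterate_succ_apply' M.face]
    rw [← Function.iterate_mod_minimalPeriod_eq, hN, Fin.val_add, Fin.val_one', Nat.add_mod_mod]
  have hmono : M.IsMonoCycle col i c := by
    refine ⟨fun k => ⟨hopp _, (hcol k).1, ?_⟩, fun k l hkl => ?_⟩
    · rw [← hface]; exact M.sameVertex_opp_face _
    · have h1 := SchnyderAt.out_unique M (hs _) (hcol k).1 (hcol l).1 hkl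
      exact Fin.ext (Function.iterate_injOn_Iio_minimalPeriod (f := M.face) (x := d)
        (by simpa [hN] using k.is_le) (by simpa [hN] using l.is_le)
        (by simpa only [iterate_eq_pow] using h1))
  obtain ⟨m, c', hm', k, l, hkl⟩ := (hc i).1 N c hmono
  -- `rot (c k)` is the outgoing edge of color `i + 1` at the common vertex, so that an edge entering
  -- with color `i - 1` would have to be `c k` or `rot (c k)`, which enter with other colors
  -- `y` is the edge of color `i - 1` entering the common vertex, seen from that vertex
  set y := M.opp (c' (l - 1)) with hy
  have hyc : col (M.opp y) = some (i - 1) := by rw [hy, M.opp_opp]; exact (hm'.1 (l - 1)).2.1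
  have hyv : M.SameVertex (c k) y := by
    have := (hm'.1 (l - 1)).2.2
    rw [sub_add_cancel] at this
    exact hkl.trans this.symm
  have hrot : M.rot (c k) = M.opp (c (k - 1)) := by
    have := hface (k - 1)
    rw [sub_add_cancel] at this
    rw [← this, rot_face]
  have hrc : col (M.rot (c k)) = some (i + 1) := by
    rw [hrot, (hcol _).2, hi]; congr 1; ring
  have hck : col (c k) = some i := (hcol k).1
  rcases hyn : col y with _ | j
  · have hly := h.of_enters y (i - 1) ⟨hopp y, hyc⟩ hyn
    obtain ⟨n, hn, hlt⟩ := h.prev y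
    rw [hly, sub_add_cancel] at hn
    have h1 : (M.rot⁻¹ ^ n) y = c k :=
      SchnyderAt.out_unique M (hs _) hn hck
        ((sameCycle_of_natPow (σ := M.rot⁻¹) n rfl |> sameCycle_inv.1).symm.trans hyv.symm)
    rcases n with _ | n
    · rw [show y = c k from h1, hck] at hyn
      simp at hyn
    · have h2 : (M.rot⁻¹ ^ n) y = M.rot (c k) := by
        rw [← h1, pow_succ', mul_apply, ← mul_apply M.rot, mul_inv_cancel, one_apply]
      have h3 := hlt n (by omega)
      rw [h2, hrc] at h3
      simp at h3
  · have hne := (ho y).2 (hopp y) (by simp [hyn])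
    have hj : j = i ∨ j = i + 1 ∨ j = i - 1 := by
      clear_value i; clear * -; revert i j; decide
    rcases hj with rfl | rfl | rfl
    · have h1 := SchnyderAt.out_unique M (hs _) hck hyn hyv
      rw [← h1, (hcol k).2] at hyc
      have h2 := Option.some.inj hyc
      rw [hi] at h2
      generalize ℓ d = t at h2
      clear * - h2; revert t; decide
    · have h1 := SchnyderAt.out_unique M (hs _) hrc hyn
        ((sameCycle_apply_left.2 hyv))
      rw [← h1, hrot, M.opp_opp, (hcol _).1] at hyc
      have h2 := Option.some.inj hyc
      clear_value i
      clear * - h2; revert i; decide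
    · exact hne (by rw [hyn, hyc])

end CMap

/-! ### Counting orbits -/

open Classical in
theorem Fintype.sum_filter_eq_card_mul {β Q : Type*} [Fintype β] [Finite Q] (f : β → Q)
    (P : Q → Prop) (g : β → ℤ) (c : ℤ) (h : ∀ q, P q → ∑ y with f y = q, g y = c) :
    ∑ y with P (f y), g y = Nat.card {q // P q} * c := by
  have := Fintype.ofFinite Q
  rw [← Finset.sum_fiberwise_of_maps_to (s := Finset.univ.filter fun y => P (f y))
    (t := Finset.univ.filter P) (g := f) (by simp)]
  rw [Finset.sum_congr rfl (g := fun _ => c)]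
  · rw [Finset.sum_const, Nat.card_eq_fintype_card, Fintype.card_subtype, nsmul_eq_mul]
  · intro q hq
    rw [← h q (by simpa using hq), Finset.filter_filter]
    refine Finset.sum_congr (Finset.filter_congr fun y _ => ?_) fun _ _ => rfl
    refine ⟨fun h => h.2, fun h => ⟨?_, h⟩⟩
    rw [h]; simpa using hq

namespace Equiv.Perm

variable {α : Type*} (σ : Equiv.Perm α)

/-- All points of the orbit `q` have the property `P`. -/
def OrbitIn (P : α → Prop) (q : Quotient (SameCycle.setoid σ)) : Prop :=
  ∀ x, σ.orbit x = q → P x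

/-- The number of orbits contained in the set `P`. -/
noncomputable def numOrbits (P : α → Prop) : ℕ := Nat.card {q // σ.OrbitIn P q}

variable {σ}

theorem orbitIn_orbit {P : α → Prop} (hP : ∀ x, P (σ x) ↔ P x) (x : α) :
    σ.OrbitIn P (σ.orbit x) ↔ P x :=
  ⟨fun h => h x rfl, fun h _ hy =>
    ((orbit_eq_orbit.1 hy).iff_of_invariant hP).2 h⟩

open Classical in
theorem sum_eq_numOrbits_mul [Fintype α] {P : α → Prop} (hP : ∀ x, P (σ x) ↔ P x)
    (g : α → ℤ) (c : ℤ) (h : ∀ x, P x → ∑ y with σ.SameCycle x y, g y = c) :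
    ∑ x with P x, g x = σ.numOrbits P * c := by
  rw [numOrbits, ← Fintype.sum_filter_eq_card_mul σ.orbit (σ.OrbitIn P) g c]
  · simp only [orbitIn_orbit hP]
  · intro q hq
    obtain ⟨x, rfl⟩ := exists_orbit q
    rw [← h x (hq x rfl)]
    refine Finset.sum_congr ?_ fun _ _ => rfl
    ext y
    simp only [Finset.mem_filter, orbit_eq_orbit, sameCycle_comm]

/-- The rational functions that are invariant under `σ` and vanish outside `P`. -/
def invFun (σ : Equiv.Perm α) (P : α → Prop) : Submodule ℚ (α → ℚ) where
  carrier := {φ | (∀ x, φ (σ x) = φ x) ∧ ∀ x, ¬ P x → φ x = 0}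
  add_mem' := by
    rintro φ ψ ⟨h1, h2⟩ ⟨h3, h4⟩
    exact ⟨fun x => by simp [h1, h3], fun x hx => by simp [h2 x hx, h4 x hx]⟩
  zero_mem' := by simp
  smul_mem' := by
    rintro c φ ⟨h1, h2⟩
    exact ⟨fun x => by simp [h1], fun x hx => by simp [h2 x hx]⟩

open Classical in
theorem finrank_invFun [Finite α] {P : α → Prop} (hP : ∀ x, P (σ x) ↔ P x) :
    Module.finrank ℚ (invFun σ P) = σ.numOrbits P := by
  have := Fintype.ofFinite {q // σ.OrbitIn P q}
  let e : invFun σ P ≃ₗ[ℚ] ({q // σ.OrbitIn P q} → ℚ) :=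
    { toFun := fun φ q => φ.1 (exists_orbit q.1).choose
      map_add' := fun φ ψ => rfl
      map_smul' := fun c φ => rfl
      invFun := fun ψ => ⟨fun x => if h : σ.OrbitIn P (σ.orbit x) then ψ ⟨_, h⟩ else 0, by
        refine ⟨fun x => ?_, fun x hx => ?_⟩
        · simp only [orbit_apply]
        · exact dif_neg ((orbitIn_orbit hP x).not.2 hx)⟩
      left_inv := by
        rintro ⟨φ, h1, h2⟩
        ext x
        dsimp only
        split_ifs with h
        · exact (orbit_eq_orbit.1 (exists_orbit (σ.orbit x)).choose_spec).eq_of_invariant h1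
        · rw [orbitIn_orbit hP] at h
          exact (h2 x h).symm
      right_inv := by
        rintro ψ
        ext ⟨q, hq⟩
        have h := (exists_orbit q).choose_spec
        dsimp only
        have h' : σ.OrbitIn P (σ.orbit (exists_orbit q).choose) := by rwa [h]
        rw [dif_pos h']
        congr 2 }
  rw [e.finrank_eq, Module.finrank_fintype_fun_eq_card, numOrbits, Nat.card_eq_fintype_card]

theorem numOrbits_true [Finite α] :
    σ.numOrbits (fun _ => True) = Nat.card (Quotient (SameCycle.setoid σ)) := by
  refine Nat.card_congr (Equiv.subtypeUnivEquiv fun q => ?_)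
  intro x _; trivial

end Equiv.Perm

/-! ### An inequality of Euler type -/

namespace CMap

open Equiv.Perm

variable {D : Type*} (M : CMap D)

theorem Connected.eq_of_invariant {M : CMap D} (h : M.Connected) {β : Type*} {f : D → β}
    (h1 : ∀ d, f (M.rot d) = f d) (h2 : ∀ d, f (M.opp d) = f d) (x y : D) : f x = f y := by
  obtain ⟨g, hg, rfl⟩ := h x y
  suffices ∀ d, f (g d) = f d from (this x).symm
  induction hg using Subgroup.closure_induction with
  | mem g hg =>
    rcases hg with rfl | rfl
    · exact h1
    · exact h2
  | one => simp
  | mul g g' _ _ h h' => intro d; rw [mul_apply, h, h']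
  | inv g _ h => intro d; rw [← h (g⁻¹ d), ← mul_apply, mul_inv_cancel, one_apply]

theorem sameCycle_opp {d e : D} : M.opp.SameCycle d e ↔ e = d ∨ e = M.opp d := by
  constructor
  · intro h
    refine (h.iff_of_invariant (p := fun e => e = d ∨ e = M.opp d) fun x => ?_).1 (Or.inl rfl)
    constructor
    · rintro (h | h)
      · exact Or.inr (by rw [← h, M.opp_opp])
      · exact Or.inl (M.opp.injective h)
    · rintro (rfl | rfl)
      · exact Or.inr rfl
      · exact Or.inl (M.opp_opp d)
  · rintro (rfl | rfl)
    · exact SameCycle.refl _ _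
    · exact sameCycle_apply_right.2 (SameCycle.refl _ _)

open Classical in
/-- Each edge has two darts. -/
theorem sum_edges [Fintype D] (hopp : ∀ d, M.opp d ≠ d) {E : D → Prop}
    (hE : ∀ d, E (M.opp d) ↔ E d) (g : D → ℤ) (c : ℤ)
    (h : ∀ d, E d → g d + g (M.opp d) = c) :
    ∑ d with E d, g d = M.opp.numOrbits E * c := by
  refine sum_eq_numOrbits_mul hE g c fun d hd => ?_
  rw [← h d hd, ← Finset.sum_pair (hopp d).symm]
  refine Finset.sum_congr ?_ fun _ _ => rfl
  ext e
  simp [sameCycle_opp]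

/-- The functions on the faces in `X` that take the same value on both sides of each edge
of `E`. -/
def constAcross (X E : D → Prop) : Submodule ℚ (D → ℚ) where
  carrier := {φ | φ ∈ invFun M.face X ∧ ∀ d, E d → φ (M.opp d) = φ d}
  add_mem' := by
    rintro φ ψ ⟨h1, h2⟩ ⟨h3, h4⟩
    exact ⟨add_mem h1 h3, fun d hd => by simp [h2 d hd, h4 d hd]⟩
  zero_mem' := ⟨zero_mem _, by simp⟩
  smul_mem' := by
    rintro c φ ⟨h1, h2⟩
    exact ⟨Submodule.smul_mem _ c h1, fun d hd => by simp [h2 d hd]⟩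

/-- The differences of a function on the faces sum to zero around each vertex. -/
theorem sum_boundary_mul [Fintype D] {φ π : D → ℚ} (hφ : ∀ d, φ (M.face d) = φ d)
    (hπ : ∀ d, π (M.rot d) = π d) : ∑ d, (φ d - φ (M.opp d)) * π d = 0 := by
  have hr : ∀ d, φ (M.opp (M.rot d)) = φ d := fun d => by rw [← hφ, face_opp_rot]
  have h : ∑ d, φ (M.opp d) * π d = ∑ d, φ d * π d := by
    rw [← Equiv.sum_comp M.rot fun d => φ (M.opp d) * π d]
    exact Finset.sum_congr rfl fun d _ => by rw [hr, hπ]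
  simp only [sub_mul, Finset.sum_sub_distrib, h, sub_self]

/-- The differences of a function on the faces are orthogonal to those of a function on the
vertices. -/
theorem sum_boundary_mul_gradient [Fintype D] {φ π : D → ℚ} (hφ : ∀ d, φ (M.face d) = φ d)
    (hπ : ∀ d, π (M.rot d) = π d) :
    ∑ d, (φ d - φ (M.opp d)) * (π d - π (M.opp d)) = 0 := by
  have h := M.sum_boundary_mul hφ hπ
  have h' := h
  rw [← Equiv.sum_comp M.opp] at h'
  simp only [mul_sub, Finset.sum_sub_distrib]
  rw [h, zero_sub, neg_eq_zero, ← neg_eq_zero, ← Finset.sum_neg_distrib, ← h']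
  exact Finset.sum_congr rfl fun d _ => by rw [M.opp_opp]; ring

open Classical in
/-- The function on the darts of `E` made of the differences of a function on the faces, of those
of a function on the vertices, and of a function on the edges. The functions on faces, vertices and
edges live on `X`, `W` and `E`. -/
noncomputable def decompositionMap (X W E : D → Prop) :
    (invFun M.face X × invFun M.rot W × invFun M.opp E) →ₗ[ℚ] (D → ℚ) where
  toFun p d := if E d then
    (p.1.1 d - p.1.1 (M.opp d)) + (p.2.1.1 d - p.2.1.1 (M.opp d)) + p.2.2.1 d else 0
  map_add' p q := by
    ext d
    simp only [Prod.fst_add, Prod.snd_add, Submodule.coe_add, Pi.add_apply]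
    split_ifs <;> ring
  map_smul' c p := by
    ext d
    simp only [Prod.smul_fst, Prod.smul_snd, Submodule.coe_smul, Pi.smul_apply, smul_eq_mul,
      RingHom.id_apply]
    split_ifs <;> ring

/-- On the kernel of `decompositionMap` the functions on the vertices and on the edges vanish, and
the function on the faces has no differences across the edges of `E`. Indeed the
differences are antisymmetric, which separates off the functions on the edges, and the differences
of functions on the faces are orthogonal to those of functions on the vertices; finally, a function
on the vertices without differences is constant, hence zero as it vanishes at some vertex. -/
theorem decompositionMap_eq_zero [Finite D] (hconn : M.Connected) {X W E : D → Prop}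
    (hE : ∀ d, E (M.opp d) ↔ E d) (hWE : ∀ d, W d → E d) (hW' : ∃ d, ¬ W d)
    {p : invFun M.face X × invFun M.rot W × invFun M.opp E}
    (hp : M.decompositionMap X W E p = 0) :
    (∀ d, E d → p.1.1 (M.opp d) = p.1.1 d) ∧ p.2 = 0 := by
  have := Fintype.ofFinite D
  obtain ⟨⟨φ, hφ1, hφ2⟩, ⟨π, hπ1, hπ2⟩, ⟨s, hs1, hs2⟩⟩ := p
  have h0 : ∀ d, E d → (φ d - φ (M.opp d)) + (π d - π (M.opp d)) + s d = 0 := fun d hd => by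
    simpa [decompositionMap, hd] using congrFun hp d
  have hs : ∀ d, s d = 0 := by
    intro d
    by_cases hd : E d
    · have h1 := h0 d hd
      have h2 := h0 _ ((hE d).2 hd)
      rw [M.opp_opp, hs1] at h2
      linarith
    · exact hs2 d hd
  have hπE : ∀ d, ¬ E d → π d - π (M.opp d) = 0 := by
    intro d hd
    rw [hπ2 d fun h => hd (hWE d h), hπ2 (M.opp d) fun h => hd ((hE d).1 (hWE _ h)), sub_zero]
  have hsq : ∑ d, (π d - π (M.opp d)) ^ 2 = 0 := by
    rw [← neg_eq_zero, ← M.sum_boundary_mul_gradient hφ1 hπ1, ← Finset.sum_neg_distrib]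
    refine Finset.sum_congr rfl fun d _ => ?_
    by_cases hd : E d
    · rw [show φ d - φ (M.opp d) = -(π d - π (M.opp d)) by
        have := h0 d hd; rw [hs] at this; linarith]
      ring
    · rw [hπE d hd]; ring
  have hgrad : ∀ d, π (M.opp d) = π d := by
    intro d
    have h1 := (Finset.sum_eq_zero_iff_of_nonneg fun d _ => sq_nonneg _).1 hsq d
      (Finset.mem_univ d)
    have h2 := pow_eq_zero_iff (two_ne_zero) |>.1 h1
    linarith
  have hπ : π = 0 := by
    obtain ⟨d₀, hd₀⟩ := hW'
    ext d
    rw [hconn.eq_of_invariant hπ1 hgrad d d₀, hπ2 d₀ hd₀]; rfl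
  refine ⟨fun d hd => ?_, ?_⟩
  · have := h0 d hd
    rw [hs, hgrad] at this
    simp only
    linarith
  · ext d
    · simp [hπ]
    · simp [hs]

/-- Let `X` be a set of faces, `E` a set of edges and `W` a proper subset of the set of
vertices, such that the edges at the vertices of `W` are in `E`. Then `W` and `X`
together have at most as many elements as `E`, up to the number of degrees of freedom of a function
on `X` that takes equal values on both sides of the edges of `E`. This is the rank-nullity
theorem for `decompositionMap`, whose values form a space of dimension at most `2 |E|`. -/
theorem numOrbits_add_le [Finite D] (hopp : ∀ d, M.opp d ≠ d) (hconn : M.Connected)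
    {X W E : D → Prop} (hX : ∀ d, X (M.face d) ↔ X d) (hW : ∀ d, W (M.rot d) ↔ W d)
    (hE : ∀ d, E (M.opp d) ↔ E d) (hWE : ∀ d, W d → E d) (hW' : ∃ d, ¬ W d) :
    M.face.numOrbits X + M.rot.numOrbits W ≤
      M.opp.numOrbits E + Module.finrank ℚ (M.constAcross X E) := by
  classical
  have := Fintype.ofFinite D
  have hrn := (M.decompositionMap X W E).finrank_range_add_finrank_ker
  rw [Module.finrank_prod, Module.finrank_prod, finrank_invFun hX, finrank_invFun hW,
    finrank_invFun hE] at hrn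
  have hrange : Module.finrank ℚ (LinearMap.range (M.decompositionMap X W E)) ≤
      2 * M.opp.numOrbits E := by
    have hle : LinearMap.range (M.decompositionMap X W E) ≤ invFun (1 : Equiv.Perm D) E := by
      rintro _ ⟨p, rfl⟩
      exact ⟨fun d => rfl, fun d hd => by simp [decompositionMap, hd]⟩
    refine (Submodule.finrank_mono hle).trans ?_
    rw [finrank_invFun fun _ => Iff.rfl]
    have h1 := sum_eq_numOrbits_mul (σ := (1 : Equiv.Perm D)) (P := E) (fun _ => Iff.rfl)
      (fun _ => 1) 1 (by simp [Finset.filter_eq])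
    have h2 := M.sum_edges hopp hE (fun _ => 1) 2 (by intros; norm_num)
    rw [h1] at h2
    omega
  have hker : Module.finrank ℚ (LinearMap.ker (M.decompositionMap X W E)) ≤
      Module.finrank ℚ (M.constAcross X E) := by
    let F : LinearMap.ker (M.decompositionMap X W E) →ₗ[ℚ] M.constAcross X E :=
      { toFun := fun p => ⟨p.1.1.1, p.1.1.2,
          (M.decompositionMap_eq_zero hconn hE hWE hW' p.2).1⟩
        map_add' := fun p q => rfl
        map_smul' := fun c p => rfl }
    refine LinearMap.finrank_le_finrank_of_injective (f := F) ?_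
    intro p q hpq
    have h1 : p.1.1 = q.1.1 := Subtype.ext ((congrArg Subtype.val hpq :))
    have h2 := (M.decompositionMap_eq_zero hconn hE hWE hW' p.2).2
    have h3 := (M.decompositionMap_eq_zero hconn hE hWE hW' q.2).2
    exact Subtype.ext (Prod.ext h1 (h2.trans h3.symm))
  omega

end CMap

/-! ### Criteria for numbers of orbits and connectedness -/

theorem Equiv.Perm.card_orbits_eq {α β : Type*} {σ : Equiv.Perm α} (f : α → β)
    (hf : ∀ x, f (σ x) = f x) (hinj : ∀ x y, f x = f y → σ.SameCycle x y)
    (hsurj : Function.Surjective f) :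
    Nat.card (Quotient (Equiv.Perm.SameCycle.setoid σ)) = Nat.card β := by
  refine Nat.card_eq_of_bijective
    (Quotient.lift f fun x y h => Equiv.Perm.SameCycle.eq_of_invariant hf h) ⟨?_, fun b => ?_⟩
  · rintro ⟨x⟩ ⟨y⟩ h
    exact Quotient.sound (hinj x y h)
  · obtain ⟨x, rfl⟩ := hsurj b
    exact ⟨Quotient.mk _ x, rfl⟩

theorem CMap.connected_of_invariant {D : Type*} (M : CMap D)
    (h : ∀ p : D → Prop, (∀ d, p (M.rot d) ↔ p d) → (∀ d, p (M.opp d) ↔ p d) →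
      ∀ x y, p x → p y) : M.Connected := by
  intro x y
  have key : ∀ s ∈ ({M.rot, M.opp} : Set (Equiv.Perm D)), ∀ d,
      (∃ g ∈ Subgroup.closure ({M.rot, M.opp} : Set (Equiv.Perm D)), g x = s d) ↔
      ∃ g ∈ Subgroup.closure ({M.rot, M.opp} : Set (Equiv.Perm D)), g x = d := by
    intro s hs d
    have hs' := Subgroup.subset_closure hs
    constructor
    · rintro ⟨g, hg, h⟩
      refine ⟨s⁻¹ * g, mul_mem (inv_mem hs') hg, ?_⟩
      rw [Equiv.Perm.mul_apply, h, ← Equiv.Perm.mul_apply, inv_mul_cancel, Equiv.Perm.one_apply]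
    · rintro ⟨g, hg, rfl⟩
      exact ⟨s * g, mul_mem hs' hg, rfl⟩
  exact h (fun d => ∃ g ∈ Subgroup.closure ({M.rot, M.opp} : Set (Equiv.Perm D)), g x = d)
    (key _ (by simp)) (key _ (by simp)) x y ⟨1, one_mem _, rfl⟩

/-! ### The suspension and the toroidal map -/

namespace RootedPlanarMap

open Equiv.Perm CMap

variable {D : Type*} (G : RootedPlanarMap D)

theorem corner_injective : Function.Injective G.corner := fun i j h =>
  G.distinct_vertices i j (by rw [h]; exact SameCycle.refl _ _)

theorem opp_ne (d : D) : G.opp d ≠ d := G.genus_zero.1 d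

theorem connected : G.Connected := G.genus_zero.2.1

open Classical in
theorem suspension_rot_inl (d : D) (hd : ∀ i, d ≠ G.corner i) :
    G.suspension.rot (Sum.inl d) = Sum.inl (G.rot d) := by
  have h : ∀ i, Equiv.swap (Sum.inl (G.corner i)) (Sum.inr i) (Sum.inl d) =
      (Sum.inl d : D ⊕ ZMod 3) := fun i =>
    Equiv.swap_apply_of_ne_of_ne (fun h => hd i (Sum.inl_injective h)) (by simp)
  simp only [suspension, mul_apply, h, sumCongr_apply, Sum.map_inl]

open Classical in
theorem suspension_rot_corner_and_inr (i : ZMod 3) :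
    G.suspension.rot (Sum.inl (G.corner i)) = Sum.inr i ∧
      G.suspension.rot (Sum.inr i) = Sum.inl (G.rot (G.corner i)) := by
  have h1 : ∀ j, i ≠ j → Equiv.swap (Sum.inl (G.corner j)) (Sum.inr j) (Sum.inl (G.corner i)) =
      (Sum.inl (G.corner i) : D ⊕ ZMod 3) := fun j hij =>
    Equiv.swap_apply_of_ne_of_ne (fun h => hij (G.corner_injective (Sum.inl_injective h))) (by simp)
  have h2 : ∀ j, i ≠ j → Equiv.swap (Sum.inl (G.corner j)) (Sum.inr j) (Sum.inr i) =
      (Sum.inr i : D ⊕ ZMod 3) := fun j hij =>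
    Equiv.swap_apply_of_ne_of_ne (by simp) (fun h => hij (Sum.inr_injective h))
  have hi : i = 0 ∨ i = 1 ∨ i = 2 := by clear * -; revert i; decide
  have h01 : (0 : ZMod 3) ≠ 1 := by decide
  have h02 : (0 : ZMod 3) ≠ 2 := by decide
  have h12 : (1 : ZMod 3) ≠ 2 := by decide
  rcases hi with rfl | rfl | rfl
  · simp only [suspension, mul_apply, h1 1 h01, h1 2 h02, h2 1 h01, h2 2 h02,
      Equiv.swap_apply_left, Equiv.swap_apply_right, sumCongr_apply, Sum.map_inl, Sum.map_inr,
      one_apply, and_self]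
  · simp only [suspension, mul_apply, h1 0 h01.symm, h1 2 h12, h2 0 h01.symm, h2 2 h12,
      Equiv.swap_apply_left, Equiv.swap_apply_right, sumCongr_apply, Sum.map_inl, Sum.map_inr,
      one_apply, and_self]
  · simp only [suspension, mul_apply, h1 0 h02.symm, h1 1 h12.symm, h2 0 h02.symm, h2 1 h12.symm,
      Equiv.swap_apply_left, Equiv.swap_apply_right, sumCongr_apply, Sum.map_inl, Sum.map_inr,
      one_apply, and_self]

theorem suspension_rot_corner (i : ZMod 3) :
    G.suspension.rot (Sum.inl (G.corner i)) = Sum.inr i :=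
  (G.suspension_rot_corner_and_inr i).1

theorem suspension_rot_inr (i : ZMod 3) :
    G.suspension.rot (Sum.inr i) = Sum.inl (G.rot (G.corner i)) :=
  (G.suspension_rot_corner_and_inr i).2

/-- The dart of the planar map at whose corner a dart of the suspension lies; for a half-edge, the
dart just before it. -/
def anchor : D ⊕ ZMod 3 → D := Sum.elim id G.corner

theorem anchor_rot (x : D ⊕ ZMod 3) :
    G.SameVertex (G.anchor x) (G.anchor (G.suspension.rot x)) := by
  rcases x with d | i
  · by_cases hd : ∃ i, d = G.corner i
    · obtain ⟨i, rfl⟩ := hd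
      rw [suspension_rot_corner]
      exact SameCycle.refl _ _
    · push Not at hd
      rw [suspension_rot_inl _ _ hd]
      exact sameCycle_apply_right.2 (SameCycle.refl _ _)
  · rw [suspension_rot_inr]
    exact sameCycle_apply_right.2 (SameCycle.refl _ _)

theorem suspension_sameVertex_anchor (x : D ⊕ ZMod 3) :
    G.suspension.SameVertex x (Sum.inl (G.anchor x)) := by
  rcases x with d | i
  · exact SameCycle.refl _ _
  · refine SameCycle.symm ?_
    have := sameCycle_apply_right.2 (SameCycle.refl G.suspension.rot (Sum.inl (G.corner i)))
    rwa [suspension_rot_corner] at this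

theorem suspension_sameVertex {x y : D ⊕ ZMod 3} :
    G.suspension.SameVertex x y ↔ G.SameVertex (G.anchor x) (G.anchor y) := by
  constructor
  · intro h
    refine orbit_eq_orbit.1 (SameCycle.eq_of_invariant
      (f := fun x => G.rot.orbit (G.anchor x)) (fun x => ?_) h)
    exact (orbit_eq_orbit.2 (G.anchor_rot x)).symm
  · intro h
    refine (G.suspension_sameVertex_anchor x).trans
      (SameCycle.trans ?_ (G.suspension_sameVertex_anchor y).symm)
    refine orbit_eq_orbit.1 (SameCycle.eq_of_invariant
      (f := fun d => G.suspension.rot.orbit (Sum.inl d)) (fun d => ?_) h)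
    by_cases hd : ∃ i, d = G.corner i
    · obtain ⟨i, rfl⟩ := hd
      rw [← suspension_rot_inr, orbit_apply, ← suspension_rot_corner, orbit_apply]
    · push Not at hd
      rw [← suspension_rot_inl _ _ hd, orbit_apply]

theorem suspension_opp_inl (d : D) : G.suspension.opp (Sum.inl d) = Sum.inl (G.opp d) := rfl

theorem suspension_opp_inr (i : ZMod 3) : G.suspension.opp (Sum.inr i) = Sum.inr i := rfl

theorem plus_rot_inl (x : D ⊕ ZMod 3) : G.plus.rot (Sum.inl x) = Sum.inl (G.suspension.rot x) := rfl

theorem plus_rot_inr (x : VDart) : G.plus.rot (Sum.inr x) = Sum.inr (VDart.rot x) := rfl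

theorem plus_opp_inl_inl (d : D) :
    G.plus.opp (Sum.inl (Sum.inl d)) = Sum.inl (Sum.inl (G.opp d)) := rfl

theorem plus_opp_inl_inr (i : ZMod 3) :
    G.plus.opp (Sum.inl (Sum.inr i)) = Sum.inr (VDart.spoke i) := rfl

theorem plus_opp_spoke (i : ZMod 3) :
    G.plus.opp (Sum.inr (VDart.spoke i)) = Sum.inl (Sum.inr i) := rfl

theorem plus_opp_pre (i : ZMod 3) :
    G.plus.opp (Sum.inr (VDart.pre i)) = Sum.inr (VDart.post (i + 1)) := rfl

theorem plus_opp_post (i : ZMod 3) :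
    G.plus.opp (Sum.inr (VDart.post i)) = Sum.inr (VDart.pre (i - 1)) := rfl

theorem plus_opp_ne (x : (D ⊕ ZMod 3) ⊕ VDart) : G.plus.opp x ≠ x := by
  rcases x with (d | i) | (i | i | i)
  · rw [plus_opp_inl_inl]
    exact fun h => G.opp_ne d (Sum.inl_injective (Sum.inl_injective h))
  all_goals simp [plus_opp_inl_inr, plus_opp_spoke, plus_opp_pre, plus_opp_post]

theorem plus_rot_pow_inl (n : ℕ) (x : D ⊕ ZMod 3) :
    (G.plus.rot ^ n) (Sum.inl x) = Sum.inl ((G.suspension.rot ^ n) x) := by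
  induction n with
  | zero => rfl
  | succ n ih => rw [pow_succ', mul_apply, ih, plus_rot_inl, pow_succ', mul_apply]

theorem plus_rot_pow_inr (n : ℕ) (x : VDart) :
    (G.plus.rot ^ n) (Sum.inr x) = Sum.inr ((VDart.rot ^ n) x) := by
  induction n with
  | zero => rfl
  | succ n ih => rw [pow_succ', mul_apply, ih, plus_rot_inr, pow_succ', mul_apply]

theorem VDart.sameCycle_rot (x y : VDart) : VDart.rot.SameCycle x y := by
  have h1 : ∀ i, VDart.rot.orbit (VDart.spoke i) = VDart.rot.orbit (VDart.pre i) := fun i =>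
    orbit_apply (σ := VDart.rot) (VDart.pre i)
  have h2 : ∀ i, VDart.rot.orbit (VDart.post i) = VDart.rot.orbit (VDart.spoke i) := fun i =>
    orbit_apply (σ := VDart.rot) (VDart.spoke i)
  have h3 : ∀ i, VDart.rot.orbit (VDart.pre (i + 1)) = VDart.rot.orbit (VDart.post i) := fun i =>
    orbit_apply (σ := VDart.rot) (VDart.post i)
  have h4 : ∀ i, VDart.rot.orbit (VDart.pre i) = VDart.rot.orbit (VDart.pre 0) := by
    have h5 := fun i => (h3 i).trans ((h2 i).trans (h1 i))
    intro i
    have hi : i = 0 ∨ i = 0 + 1 ∨ i = 0 + 1 + 1 := by clear * -; revert i; decide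
    rcases hi with rfl | rfl | rfl
    · rfl
    · exact h5 0
    · exact (h5 _).trans (h5 _)
  have h6 : ∀ x, VDart.rot.orbit x = VDart.rot.orbit (VDart.pre 0) := by
    rintro (i | i | i)
    · rw [h1, h4]
    · exact h4 i
    · rw [h2, h1, h4]
  exact orbit_eq_orbit.1 ((h6 x).trans (h6 y).symm)

theorem plus_sameVertex_inl {x y : D ⊕ ZMod 3} :
    G.plus.SameVertex (Sum.inl x) (Sum.inl y) ↔ G.suspension.SameVertex x y := by
  constructor
  · intro h
    have := SameCycle.eq_of_invariant
      (f := Sum.elim (fun x => some (G.suspension.rot.orbit x)) fun _ => none)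
      (by
        rintro (x | x)
        · simp only [plus_rot_inl, Sum.elim_inl, orbit_apply]
        · simp only [plus_rot_inr, Sum.elim_inr]) h
    exact orbit_eq_orbit.1 (Option.some.inj this)
  · intro h
    refine orbit_eq_orbit.1 (SameCycle.eq_of_invariant
      (f := fun x => G.plus.rot.orbit (Sum.inl x)) (fun x => ?_) h)
    rw [← plus_rot_inl, orbit_apply]

theorem plus_sameVertex_inr (x y : VDart) : G.plus.SameVertex (Sum.inr x) (Sum.inr y) := by
  refine orbit_eq_orbit.1 (SameCycle.eq_of_invariant
    (f := fun x => G.plus.rot.orbit (Sum.inr x)) (fun x => ?_) (VDart.sameCycle_rot x y))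
  rw [← plus_rot_inr, orbit_apply]

theorem not_plus_sameVertex_inl_inr (x : D ⊕ ZMod 3) (y : VDart) :
    ¬ G.plus.SameVertex (Sum.inl x) (Sum.inr y) := by
  intro h
  have := h.eq_of_invariant (f := Sum.isLeft) (by rintro (x | x) <;> rfl)
  simp at this

theorem plus_inSector_inl {x z y : D ⊕ ZMod 3} :
    G.plus.InSector (Sum.inl x) (Sum.inl z) (Sum.inl y) ↔ G.suspension.InSector x z y := by
  simp only [InSector, plus_rot_pow_inl, Sum.inl.injEq, ne_eq]

theorem plus_face_inl_inl (d : D) (hd : ∀ i, G.face d ≠ G.corner i) :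
    G.plus.face (Sum.inl (Sum.inl d)) = Sum.inl (Sum.inl (G.face d)) := by
  refine G.plus.rot.injective ?_
  rw [rot_face, plus_rot_inl, suspension_rot_inl _ _ hd, rot_face]; rfl

theorem plus_face_of_corner {d : D} {i : ZMod 3} (hd : G.face d = G.corner i) :
    G.plus.face (Sum.inl (Sum.inl d)) = Sum.inl (Sum.inr i) := by
  refine G.plus.rot.injective ?_
  rw [rot_face, plus_rot_inl, suspension_rot_inr, ← hd, rot_face]; rfl

theorem plus_face_inl_inr (i : ZMod 3) :
    G.plus.face (Sum.inl (Sum.inr i)) = Sum.inr (VDart.pre i) := by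
  refine G.plus.rot.injective ?_
  rw [rot_face]; rfl

theorem plus_face_spoke (i : ZMod 3) :
    G.plus.face (Sum.inr (VDart.spoke i)) = Sum.inl (Sum.inl (G.corner i)) := by
  refine G.plus.rot.injective ?_
  rw [rot_face, plus_rot_inl, suspension_rot_corner]; rfl

theorem plus_face_pre (i : ZMod 3) :
    G.plus.face (Sum.inr (VDart.pre i)) = Sum.inr (VDart.spoke (i + 1)) := by
  refine G.plus.rot.injective ?_
  rw [rot_face]; rfl

theorem plus_face_post (i : ZMod 3) :
    G.plus.face (Sum.inr (VDart.post i)) = Sum.inr (VDart.post (i + 1)) := by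
  refine G.plus.rot.injective ?_
  rw [rot_face, plus_opp_post, plus_rot_inr]
  show _ = Sum.inr (VDart.pre (i + 1 + 1))
  congr 2
  revert i; decide

theorem plus_connected : G.plus.Connected := by
  refine connected_of_invariant _ fun p h1 h2 => ?_
  have hc : ∀ i, p (Sum.inl (Sum.inr i)) ↔ p (Sum.inl (Sum.inl (G.corner i))) := fun i => by
    rw [← h1 (Sum.inl (Sum.inl (G.corner i))), plus_rot_inl, suspension_rot_corner]
  have hr : ∀ d, p (Sum.inl (Sum.inl (G.rot d))) ↔ p (Sum.inl (Sum.inl d)) := by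
    intro d
    by_cases hd : ∃ i, d = G.corner i
    · obtain ⟨i, rfl⟩ := hd
      rw [← suspension_rot_inr, ← plus_rot_inl, h1, hc]
    · push Not at hd
      rw [← suspension_rot_inl _ _ hd, ← plus_rot_inl, h1]
  have hD : ∀ d, p (Sum.inl (Sum.inl d)) ↔ p (Sum.inl (Sum.inl (G.corner 0))) := fun d =>
    iff_of_eq (G.connected.eq_of_invariant (f := fun d => p (Sum.inl (Sum.inl d)))
      (fun d => propext (hr d)) (fun d => propext (h2 (Sum.inl (Sum.inl d)))) _ _)
  have hV : ∀ x, p (Sum.inr x) ↔ p (Sum.inl (Sum.inl (G.corner 0))) := by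
    intro x
    rw [(G.plus_sameVertex_inr x (VDart.spoke 0)).iff_of_invariant h1, ← h2, plus_opp_spoke, hc]
  have hall : ∀ x, p x ↔ p (Sum.inl (Sum.inl (G.corner 0))) := by
    rintro ((d | i) | x)
    · exact hD d
    · rw [hc]; exact hD _
    · exact hV x
  intro x y h
  exact (hall y).2 ((hall x).1 h)

/-! ### The genus of the toroidal map -/

theorem card_plus_vertices [Finite D] : Nat.card G.plus.Vertices = Nat.card G.Vertices + 1 := by
  have : Finite G.Vertices := Quotient.finite _
  rw [← Finite.card_option]
  refine card_orbits_eq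
    (Sum.elim (fun x => some (G.rot.orbit (G.anchor x))) fun _ => none) ?_ ?_ ?_
  · rintro (x | x)
    · simp only [plus_rot_inl, Sum.elim_inl]
      rw [orbit_eq_orbit.2 (G.anchor_rot x)]
    · rfl
  · rintro (x | x) (y | y) h
    · exact G.plus_sameVertex_inl.2 (G.suspension_sameVertex.2
        (orbit_eq_orbit.1 (Option.some.inj h)))
    · simp at h
    · simp at h
    · exact G.plus_sameVertex_inr x y
  · rintro (_ | q)
    · exact ⟨Sum.inr (VDart.pre 0), rfl⟩
    · obtain ⟨d, rfl⟩ := exists_orbit q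
      exact ⟨Sum.inl (Sum.inl d), rfl⟩

theorem card_plus_edges [Finite D] : Nat.card G.plus.Edges = Nat.card G.Edges + 6 := by
  have : Finite G.Edges := Quotient.finite _
  have h6 : Nat.card (ZMod 3 ⊕ ZMod 3) = 6 := by simp
  rw [← h6, ← Nat.card_sum]
  refine card_orbits_eq (fun x => match x with
    | Sum.inl (Sum.inl d) => Sum.inl (G.opp.orbit d)
    | Sum.inl (Sum.inr i) => Sum.inr (Sum.inl i)
    | Sum.inr (VDart.spoke i) => Sum.inr (Sum.inl i)
    | Sum.inr (VDart.pre i) => Sum.inr (Sum.inr i)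
    | Sum.inr (VDart.post i) => Sum.inr (Sum.inr (i - 1))) ?_ ?_ ?_
  · rintro ((d | i) | (i | i | i))
    · simp only [plus_opp_inl_inl, orbit_apply]
    all_goals simp [plus_opp_inl_inr, plus_opp_spoke, plus_opp_pre, plus_opp_post]
  · rintro ((d | i) | (i | i | i)) ((e | j) | (j | j | j)) h <;>
      simp only [Sum.inl.injEq, Sum.inr.injEq, reduceCtorEq, sub_left_inj] at h <;>
      simp only [sameCycle_opp, plus_opp_inl_inl, plus_opp_inl_inr, plus_opp_spoke, plus_opp_pre,
        plus_opp_post, h, sub_add_cancel, true_or, or_true]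
    rcases G.sameCycle_opp.1 (orbit_eq_orbit.1 (Sum.inl_injective h)) with rfl | rfl <;> simp
  · rintro (q | i | i)
    · obtain ⟨d, rfl⟩ := exists_orbit q
      exact ⟨Sum.inl (Sum.inl d), rfl⟩
    · exact ⟨Sum.inl (Sum.inr i), rfl⟩
    · exact ⟨Sum.inr (VDart.pre i), rfl⟩

/-- Following the face on the left of `d`, the first of the three corners met after leaving `d` is
the `i`-th one. -/
def NextCorner (d : D) (i : ZMod 3) : Prop :=
  ∃ n : ℕ, (G.face ^ (n + 1)) d = G.corner i ∧ ∀ m < n, ∀ j, (G.face ^ (m + 1)) d ≠ G.corner j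

theorem NextCorner.unique {d : D} {i j : ZMod 3} (hi : G.NextCorner d i) (hj : G.NextCorner d j) :
    i = j := by
  obtain ⟨n, h1, h2⟩ := hi
  obtain ⟨m, h3, h4⟩ := hj
  rcases lt_trichotomy n m with h | rfl | h
  · exact absurd h1 (h4 n h i)
  · exact G.corner_injective (h1.symm.trans h3)
  · exact absurd h3 (h2 m h j)

theorem NextCorner.of_face {d : D} {i : ZMod 3} (h : G.NextCorner (G.face d) i)
    (hd : ∀ j, G.face d ≠ G.corner j) : G.NextCorner d i := by
  obtain ⟨n, h1, h2⟩ := h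
  refine ⟨n + 1, by rwa [pow_succ, mul_apply], ?_⟩
  rintro (_ | m) hm j
  · exact hd j
  · rw [pow_succ, mul_apply]; exact h2 m (by omega) j

theorem sameCycle_face_corner (i : ZMod 3) : G.face.SameCycle (G.corner 0) (G.corner i) := by
  obtain ⟨a, b, -, -, -, h1, h2⟩ := G.ccw_on_outer_face
  have hi : i = 0 ∨ i = 1 ∨ i = 2 := by clear * -; revert i; decide
  rcases hi with rfl | rfl | rfl
  · exact SameCycle.refl _ _
  · exact sameCycle_inv.1 (sameCycle_of_natPow a h1)
  · exact sameCycle_inv.1 (sameCycle_of_natPow b h2)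

theorem exists_nextCorner [Finite D] {d : D} (hd : G.face.SameCycle (G.corner 0) d) :
    ∃ i, G.NextCorner d i := by
  classical
  have hex : ∃ n : ℕ, ∃ i, (G.face ^ (n + 1)) d = G.corner i := by
    obtain ⟨n, hn⟩ := SameCycle.exists_natPow (σ := G.face) (x := G.face d) (y := G.corner 0)
      (sameCycle_apply_left.2 hd.symm)
    exact ⟨n, 0, by rwa [pow_succ, mul_apply]⟩
  obtain ⟨i, hi⟩ := Nat.find_spec hex
  exact ⟨i, Nat.find hex, hi, fun m hm j hj => Nat.find_min hex hm ⟨j, hj⟩⟩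

/-- The roots occur in the order `2`, `1`, `0` when the outer face is followed with that face on
the left. -/
theorem nextCorner_corner [Finite D] (i : ZMod 3) : G.NextCorner (G.corner (i + 1)) i := by
  obtain ⟨a, b, ha, hab, hb, h1, h2⟩ := G.ccw_on_outer_face
  set N := Function.minimalPeriod G.face (G.corner 0) with hN
  have hinj : ∀ x y : ℕ, x < y → y - x < N →
      (G.face⁻¹ ^ x) (G.corner 0) ≠ (G.face⁻¹ ^ y) (G.corner 0) := by
    intro x y hxy hlt h
    have hp : Function.IsPeriodicPt G.face (y - x) (G.corner 0) := by
      rw [Function.IsPeriodicPt, Function.IsFixedPt, iterate_eq_pow]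
      have h3 := congrArg (G.face ^ y) h
      rw [← mul_apply, ← mul_apply, inv_pow, inv_pow, mul_inv_cancel, one_apply,
        ← Nat.sub_add_cancel hxy.le, pow_add, mul_assoc, mul_inv_cancel, mul_one] at h3
      exact h3
    exact absurd (hp.minimalPeriod_le (by omega)) (by omega)
  have hpow : ∀ x y : ℕ, x ≤ y →
      (G.face ^ x) ((G.face⁻¹ ^ y) (G.corner 0)) = (G.face⁻¹ ^ (y - x)) (G.corner 0) := by
    intro x y hxy
    conv_lhs => rw [← Nat.add_sub_cancel' hxy, pow_add, ← mul_apply, ← mul_assoc, inv_pow,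
      mul_inv_cancel, one_mul]
  have hper : (G.face⁻¹ ^ N) (G.corner 0) = G.corner 0 := by
    rw [inv_pow, Equiv.Perm.inv_eq_iff_eq, ← iterate_eq_pow]
    exact (Function.iterate_minimalPeriod).symm
  -- position of the corners, counted backwards from `corner 0`
  have hpos : ∀ j : ZMod 3, ∃ p : ℕ, (p = 0 ∨ p = a ∨ p = b) ∧
      G.corner j = (G.face⁻¹ ^ p) (G.corner 0) := by
    intro j
    have hj : j = 0 ∨ j = 1 ∨ j = 2 := by clear * -; revert j; decide
    rcases hj with rfl | rfl | rfl
    · exact ⟨0, by simp, rfl⟩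
    · exact ⟨a, by simp, h1.symm⟩
    · exact ⟨b, by simp, h2.symm⟩
  have key : ∀ (p q : ℕ) (j j' : ZMod 3), q < p → p ≤ N → G.corner j = (G.face⁻¹ ^ p) (G.corner 0) →
      G.corner j' = (G.face⁻¹ ^ q) (G.corner 0) →
      (∀ r, r = 0 ∨ r = a ∨ r = b → r ≤ q ∨ p ≤ r) → G.NextCorner (G.corner j) j' := by
    intro p q j j' hqp hpN hj hj' hr
    refine ⟨p - q - 1, ?_, fun m hm k => ?_⟩
    · rw [hj, hpow _ _ (by omega), hj']
      congr 2; omega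
    · obtain ⟨r, hr', hk⟩ := hpos k
      rw [hk, hj, hpow _ _ (by omega)]
      rcases hr r hr' with h | h
      · exact (hinj _ _ (by omega) (by omega)).symm
      · exact hinj _ _ (by omega) (by omega)
  have hi : i = 0 ∨ i = 1 ∨ i = 2 := by clear * -; revert i; decide
  rcases hi with rfl | rfl | rfl
  · exact key a 0 _ _ ha (by omega) h1.symm rfl (by omega)
  · exact key b a _ _ hab (by omega) h2.symm h1.symm (by omega)
  · exact key N b _ _ hb le_rfl hper.symm h2.symm (by omega)

theorem NextCorner.sameCycle {d : D} {i : ZMod 3} (h : G.NextCorner d i) :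
    G.plus.face.SameCycle (Sum.inl (Sum.inl d)) (Sum.inr (VDart.pre i)) := by
  obtain ⟨n, h1, h2⟩ := h
  have hm : ∀ m ≤ n, (G.plus.face ^ m) (Sum.inl (Sum.inl d)) =
      Sum.inl (Sum.inl ((G.face ^ m) d)) := by
    intro m hm
    induction m with
    | zero => rfl
    | succ m ih =>
      rw [pow_succ', mul_apply, ih (by omega), plus_face_inl_inl, pow_succ', mul_apply]
      intro j
      have := h2 m (by omega) j
      rwa [pow_succ', mul_apply] at this
  refine sameCycle_of_natPow (n + 2) ?_
  rw [pow_succ', mul_apply, pow_succ', mul_apply, hm n le_rfl, plus_face_of_corner (i := i),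
    plus_face_inl_inr]
  rwa [pow_succ', mul_apply] at h1

open Classical in
theorem card_plus_faces [Finite D] : Nat.card G.plus.Faces = Nat.card G.Faces + 3 := by
  have : Finite G.Faces := Quotient.finite _
  rw [show Nat.card G.Faces + 3 = Nat.card (G.Faces ⊕ ZMod 3) by rw [Nat.card_sum]; simp]
  -- The outer face is divided by the spokes and the loops: the part next to the `i`-th root is
  -- counted by `i`, the triangle formed by the loops takes the place of the outer face.
  set outer : D → Prop := fun d => G.face.SameCycle (G.corner 0) d with houter
  have hof : ∀ d, outer (G.face d) ↔ outer d := fun d => sameCycle_apply_right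
  let seg : D → ZMod 3 := fun d => if h : ∃ i, G.NextCorner d i then h.choose else 0
  have hseg : ∀ d i, G.NextCorner d i → seg d = i := by
    intro d i hi
    have h : ∃ i, G.NextCorner d i := ⟨i, hi⟩
    simp only [seg, dif_pos h]
    exact NextCorner.unique G h.choose_spec hi
  have hpre : ∀ d, outer d →
      G.plus.face.SameCycle (Sum.inl (Sum.inl d)) (Sum.inr (VDart.pre (seg d))) := by
    intro d hd
    obtain ⟨i, hi⟩ := G.exists_nextCorner hd
    rw [hseg d i hi]
    exact NextCorner.sameCycle G hi
  let f : (D ⊕ ZMod 3) ⊕ VDart → G.Faces ⊕ ZMod 3 := fun x => match x with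
    | Sum.inl (Sum.inl d) => if outer d then Sum.inr (seg d) else Sum.inl (G.face.orbit d)
    | Sum.inl (Sum.inr i) => Sum.inr i
    | Sum.inr (VDart.spoke i) => Sum.inr (i - 1)
    | Sum.inr (VDart.pre i) => Sum.inr i
    | Sum.inr (VDart.post _) => Sum.inl (G.face.orbit (G.corner 0))
  let g₀ : D → G.plus.Faces := fun d =>
    if outer d then G.plus.face.orbit (Sum.inr (VDart.post 0)) else
      G.plus.face.orbit (Sum.inl (Sum.inl d))
  have hg₀ : ∀ d, g₀ (G.face d) = g₀ d := by
    intro d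
    by_cases hd : outer d
    · exact (if_pos ((hof d).2 hd)).trans (if_pos hd).symm
    · refine (if_neg fun h => hd ((hof d).1 h)).trans (Eq.trans ?_ (if_neg hd).symm)
      rw [← plus_face_inl_inl, orbit_apply]
      intro i hi
      exact hd ((hof d).1 (by rw [hi]; exact G.sameCycle_face_corner i))
  let g : G.Faces ⊕ ZMod 3 → G.plus.Faces := Sum.elim
    (Quotient.lift g₀ fun d e h => SameCycle.eq_of_invariant (σ := G.face) hg₀ h)
    fun i => G.plus.face.orbit (Sum.inr (VDart.pre i))
  have hgf : ∀ x, g (f x) = G.plus.face.orbit x := by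
    rintro ((d | i) | (i | i | i))
    · by_cases hd : outer d
      · simp only [f, if_pos hd]
        exact (orbit_eq_orbit.2 (hpre d hd)).symm
      · simp only [f, if_neg hd]
        exact if_neg hd
    · show G.plus.face.orbit (Sum.inr (VDart.pre i)) = _
      rw [← plus_face_inl_inr, orbit_apply]
    · show G.plus.face.orbit (Sum.inr (VDart.pre (i - 1))) = _
      rw [← orbit_apply, plus_face_pre, sub_add_cancel]
    · rfl
    · refine (if_pos (SameCycle.refl _ _)).trans ?_
      have h1 : ∀ i, G.plus.face.orbit (Sum.inr (VDart.post (i + 1))) =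
          G.plus.face.orbit (Sum.inr (VDart.post i)) := fun i => by
        rw [← plus_face_post, orbit_apply]
      have hi : i = 0 ∨ i = 0 + 1 ∨ i = 0 + 1 + 1 := by clear * -; revert i; decide
      rcases hi with rfl | rfl | rfl
      · rfl
      · exact (h1 0).symm
      · rw [h1, h1]
  refine card_orbits_eq f ?_ (fun x y h => orbit_eq_orbit.1 ?_) ?_
  · rintro ((d | i) | (i | i | i))
    · by_cases hd : ∃ i, G.face d = G.corner i
      · obtain ⟨i, hi⟩ := hd
        have hod : outer d := (hof d).1 (by rw [hi]; exact G.sameCycle_face_corner i)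
        rw [G.plus_face_of_corner hi]
        simp only [f, if_pos hod]
        rw [hseg d i ⟨0, by simpa using hi, by simp⟩]
      · push Not at hd
        rw [plus_face_inl_inl _ _ hd]
        simp only [f, hof]
        split_ifs with hod
        · obtain ⟨i, hi⟩ := G.exists_nextCorner ((hof d).2 hod)
          rw [hseg _ i hi, hseg _ i (NextCorner.of_face G hi hd)]
        · rw [orbit_apply]
    · rw [plus_face_inl_inr]
    · rw [plus_face_spoke]
      have := G.nextCorner_corner (i - 1)
      rw [sub_add_cancel] at this
      simp only [f]
      rw [if_pos (G.sameCycle_face_corner i), hseg _ _ this]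
    · rw [plus_face_pre]
      simp [f]
    · rw [plus_face_post]
  · rw [← hgf x, ← hgf y, h]
  · rintro (q | i)
    · obtain ⟨d, rfl⟩ := exists_orbit q
      by_cases hd : outer d
      · exact ⟨Sum.inr (VDart.post 0), congrArg Sum.inl (orbit_eq_orbit.2 hd)⟩
      · exact ⟨Sum.inl (Sum.inl d), if_neg hd⟩
    · exact ⟨Sum.inr (VDart.pre i), rfl⟩

theorem plus_isMapOfGenus_one [Finite D] : G.plus.IsMapOfGenus 1 := by
  refine ⟨G.plus_opp_ne, G.plus_connected, ?_⟩
  have h := G.genus_zero.2.2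
  rw [eulerChar] at h ⊢
  rw [card_plus_vertices, card_plus_edges, card_plus_faces]
  push_cast at h ⊢
  linarith

end RootedPlanarMap

/-! ### The structure of a toroidal Schnyder wood -/

namespace VDart

/-- The darts at the additional vertex, sorted by kind. -/
def equivSum : VDart ≃ ZMod 3 ⊕ ZMod 3 ⊕ ZMod 3 where
  toFun
    | spoke i => Sum.inl i
    | pre i => Sum.inr (Sum.inl i)
    | post i => Sum.inr (Sum.inr i)
  invFun
    | Sum.inl i => spoke i
    | Sum.inr (Sum.inl i) => pre i
    | Sum.inr (Sum.inr i) => post i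
  left_inv := by rintro (i | i | i) <;> rfl
  right_inv := by rintro (i | i | i) <;> rfl

instance : Fintype VDart := Fintype.ofEquiv _ equivSum.symm

theorem sum_eq (g : VDart → ℤ) :
    ∑ x, g x = ∑ i, g (spoke i) + (∑ i, g (pre i) + ∑ i, g (post i)) := by
  rw [← equivSum.symm.sum_comp, Fintype.sum_sum_type, Fintype.sum_sum_type]
  rfl

end VDart

theorem CMap.outs_eq_sum {D : Type*} (col : D → Option (ZMod 3)) (d : D) :
    (outs col d : ℤ) = ∑ i, if col d = some i then 1 else 0 := by
  rcases h : col d with _ | j <;> simp [outs, h]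

theorem ZMod.sum_three (g : ZMod 3 → ℤ) : ∑ i, g i = g 0 + g 1 + g 2 := Fin.sum_univ_three g

namespace RootedPlanarMap

open Equiv.Perm CMap

variable {D : Type*} (G : RootedPlanarMap D)

section

variable {G} {T : (D ⊕ ZMod 3) ⊕ VDart → Option (ZMod 3)}

open Classical in
/-- Each vertex is the origin of exactly one edge of each color. -/
theorem sum_color [Fintype D] (hs : ∀ x, G.plus.SchnyderAt T x) (i : ZMod 3) {W : D → Prop}
    (hW : ∀ d, W (G.rot d) ↔ W d) :
    ∑ x with W (G.anchor x), (if T (Sum.inl x) = some i then 1 else 0 : ℤ) =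
      G.rot.numOrbits W := by
  have h := Fintype.sum_filter_eq_card_mul (fun x => G.rot.orbit (G.anchor x)) (G.rot.OrbitIn W)
    (fun x => (if T (Sum.inl x) = some i then 1 else 0 : ℤ)) 1 ?_
  · rw [mul_one] at h
    rw [numOrbits, ← h]
    simp only [orbitIn_orbit hW]
  · intro q _
    obtain ⟨d, rfl⟩ := exists_orbit q
    obtain ⟨e, h1, h2, -⟩ := hs (Sum.inl (Sum.inl d))
    have hei := h1 i
    rcases he : e i with x₀ | y
    · rw [he] at hei
      rw [Finset.sum_eq_single x₀, if_pos hei.2]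
      · intro x hx hne
        rw [if_neg]
        intro hTx
        refine hne (Sum.inl_injective ((h2 i _ ?_ hTx).trans he))
        rw [plus_sameVertex_inl, suspension_sameVertex]
        simp only [Finset.mem_filter, Finset.mem_univ, true_and] at hx
        exact (orbit_eq_orbit.1 hx).symm
      · intro hx
        refine absurd ?_ hx
        simp only [Finset.mem_filter, Finset.mem_univ, true_and, orbit_eq_orbit]
        have := hei.1
        rw [plus_sameVertex_inl, suspension_sameVertex] at this
        exact this.symm
    · rw [he] at hei
      exact absurd hei.1 (G.not_plus_sameVertex_inl_inr _ _)

theorem sum_color_vertex (hs : ∀ x, G.plus.SchnyderAt T x) (i : ZMod 3) :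
    ∑ x, (if T (Sum.inr x) = some i then 1 else 0 : ℤ) = 1 := by
  obtain ⟨e, h1, h2, -⟩ := hs (Sum.inr (VDart.pre 0))
  have hei := h1 i
  rcases he : e i with x | y₀
  · rw [he] at hei
    exact absurd (SameCycle.symm hei.1) (G.not_plus_sameVertex_inl_inr _ _)
  · rw [he] at hei
    rw [Finset.sum_eq_single y₀, if_pos hei.2]
    · intro y _ hne
      rw [if_neg]
      intro hTy
      exact hne (Sum.inr_injective ((h2 i _ (G.plus_sameVertex_inr _ _) hTy).trans he))
    · simp

theorem sum_outs_vertex (hs : ∀ x, G.plus.SchnyderAt T x) :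
    ∑ x, (outs T (Sum.inr x) : ℤ) = 3 := by
  simp only [outs_eq_sum]
  rw [Finset.sum_comm]
  simp [sum_color_vertex hs]

theorem sum_outs [Fintype D] (hs : ∀ x, G.plus.SchnyderAt T x) :
    ∑ d, (outs T (Sum.inl (Sum.inl d)) : ℤ) + ∑ i, (outs T (Sum.inl (Sum.inr i)) : ℤ) =
      Nat.card G.Vertices * 3 := by
  rw [← Fintype.sum_sum_type fun x => (outs T (Sum.inl x) : ℤ)]
  simp only [outs_eq_sum]
  rw [Finset.sum_comm]
  have h := fun i => sum_color hs i (W := fun _ => True) fun _ => Iff.rfl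
  simp only [Finset.filter_true, numOrbits_true] at h
  simp only [h]
  simp only [Finset.sum_const, Finset.card_univ, ZMod.card, nsmul_eq_mul]
  rw [mul_comm]; rfl

variable {ℓ : (D ⊕ ZMod 3) ⊕ VDart → ZMod 3}

theorem plus_face_pow_of_not_outer {d : D} (hd : ¬ G.face.SameCycle (G.corner 0) d) (n : ℕ) :
    (G.plus.face ^ n) (Sum.inl (Sum.inl d)) = Sum.inl (Sum.inl ((G.face ^ n) d)) := by
  induction n with
  | zero => rfl
  | succ n ih =>
    rw [pow_succ', mul_apply, ih, plus_face_inl_inl, pow_succ', mul_apply]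
    intro i hi
    refine hd ((G.sameCycle_face_corner i).trans (SameCycle.symm ?_))
    rw [← hi, sameCycle_apply_right]
    exact sameCycle_of_natPow n rfl

open Classical in
/-- There are at least three changes along each inner face. -/
theorem three_le_sum_change [Fintype D] (hT : G.plus.IsToroidalWood T)
    (hℓ : G.plus.IsLabeling T ℓ) {d : D} (hd : ¬ G.face.SameCycle (G.corner 0) d) :
    3 ≤ ∑ y with G.face.SameCycle d y, G.plus.change ℓ (Sum.inl (Sum.inl y)) := by
  refine Nat.le_of_dvd (Nat.pos_of_ne_zero ?_) ?_
  · intro h0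
    obtain ⟨n, hn⟩ := hT.exists_change_ne_zero G.plus_opp_ne hℓ (Sum.inl (Sum.inl d))
    rw [plus_face_pow_of_not_outer hd] at hn
    exact hn (Finset.sum_eq_zero_iff.1 h0 _
      (Finset.mem_filter.2 ⟨Finset.mem_univ _, sameCycle_of_natPow n rfl⟩))
  · rw [← ZMod.natCast_eq_zero_iff, Nat.cast_sum]
    have h1 : ∀ y, G.face.SameCycle d y →
        ((G.plus.change ℓ (Sum.inl (Sum.inl y)) : ℕ) : ZMod 3) =
          ℓ (Sum.inl (Sum.inl (G.face y))) - ℓ (Sum.inl (Sum.inl y)) := by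
      intro y hy
      rw [eq_sub_iff_add_eq', ← label_face, plus_face_inl_inl]
      intro i hi
      refine hd ((G.sameCycle_face_corner i).trans (SameCycle.symm ?_))
      rwa [← hi, sameCycle_apply_right]
    rw [Finset.sum_congr rfl fun y hy => h1 y (Finset.mem_filter.1 hy).2, Finset.sum_sub_distrib,
      sub_eq_zero]
    exact Finset.sum_equiv G.face (by simp [sameCycle_apply_right]) (fun _ _ => rfl)

open Classical in
/-- The numbers of changes are determined by Euler's formula: the sum of all changes leaves no room
for more than three changes along an inner face, for changes along the outer face, or for a
half-edge that is not directed outwards. -/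
theorem IsToroidalWood.changes [Fintype D] (hT : G.plus.IsToroidalWood T)
    (hℓ : G.plus.IsLabeling T ℓ) :
    (∀ i, outs T (Sum.inl (Sum.inr i)) = 1) ∧
    (∀ d, G.face.SameCycle (G.corner 0) d → G.plus.change ℓ (Sum.inl (Sum.inl d)) = 0) ∧
    ∀ d, ¬ G.face.SameCycle (G.corner 0) d →
      ∑ y with G.face.SameCycle d y, G.plus.change ℓ (Sum.inl (Sum.inl y)) = 3 := by
  let F := Quotient (SameCycle.setoid G.face)
  have := Fintype.ofFinite F
  have hver := sum_outs hT.2.1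
  have hedge := G.sum_edges G.opp_ne (E := fun _ => True) (fun _ => Iff.rfl)
    (fun d => (G.plus.change ℓ (Sum.inl (Sum.inl d)) : ℤ) + outs T (Sum.inl (Sum.inl d))) 3 (by
      intro d _
      have := hℓ.change_add hT.1 (G.plus_opp_ne (Sum.inl (Sum.inl d)))
      rw [plus_opp_inl_inl] at this
      linarith)
  rw [numOrbits_true] at hedge
  simp only [Finset.filter_true, Finset.sum_add_distrib] at hedge
  have heuler := G.genus_zero.2.2
  rw [eulerChar] at heuler
  change _ + ((Nat.card F : ℕ) : ℤ) = _ at heuler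
  set s : F → ℕ := fun q =>
    ∑ y with G.face.orbit y = q, G.plus.change ℓ (Sum.inl (Sum.inl y)) with hs
  set t : F → ℕ := fun q => if q = G.face.orbit (G.corner 0) then 0 else 3 with ht
  have hsq : ∀ d, s (G.face.orbit d) =
      ∑ y with G.face.SameCycle d y, G.plus.change ℓ (Sum.inl (Sum.inl y)) := by
    intro d
    refine Finset.sum_congr ?_ fun _ _ => rfl
    ext y
    simp only [Finset.mem_filter, orbit_eq_orbit, sameCycle_comm]
  have hst : ∀ q, t q ≤ s q := by
    intro q
    obtain ⟨d, rfl⟩ := exists_orbit q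
    by_cases hd : G.face.SameCycle (G.corner 0) d
    · have : t (G.face.orbit d) = 0 := if_pos (orbit_eq_orbit.2 hd.symm)
      omega
    · have : t (G.face.orbit d) = 3 := if_neg fun h => hd (orbit_eq_orbit.1 h).symm
      rw [this, hsq]
      exact three_le_sum_change hT hℓ hd
  have hsum_s : ∑ q, s q = ∑ d, G.plus.change ℓ (Sum.inl (Sum.inl d)) :=
    Finset.sum_fiberwise _ _ _
  have hsum_t : ∑ q, t q + 3 = Nat.card F * 3 := by
    rw [← Finset.add_sum_erase _ _ (Finset.mem_univ (G.face.orbit (G.corner 0))),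
      Finset.sum_congr rfl (g := fun _ => 3) fun q hq => if_neg (Finset.ne_of_mem_erase hq)]
    have h0 : t (G.face.orbit (G.corner 0)) = 0 := if_pos rfl
    have h1 : 0 < Nat.card F := by
      rw [Nat.card_eq_fintype_card]
      exact Fintype.card_pos_iff.2 ⟨G.face.orbit (G.corner 0)⟩
    rw [h0, Finset.sum_const, Finset.card_erase_of_mem (Finset.mem_univ _), Finset.card_univ,
      ← Nat.card_eq_fintype_card, smul_eq_mul]
    change 0 + (Nat.card F - 1) * 3 + 3 = Nat.card F * 3
    omega
  have hle := fun i => outs_le_one T (Sum.inl (Sum.inr i))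
  have h0 := hle 0
  have h1 := hle 1
  have h2 := hle 2
  rw [ZMod.sum_three] at hver
  have hle' : ∑ q, t q ≤ ∑ q, s q := Finset.sum_le_sum fun q _ => hst q
  have hcast : ((∑ q, s q : ℕ) : ℤ) = ∑ d, (G.plus.change ℓ (Sum.inl (Sum.inl d)) : ℤ) := by
    rw [hsum_s]; push_cast; rfl
  change _ = ((Nat.card G.Edges : ℕ) : ℤ) * 3 at hedge
  have heq : ∀ q, t q = s q := by
    have h3 : ∑ q, t q = ∑ q, s q := by omega
    exact fun q => (Finset.sum_eq_sum_iff_of_le fun q _ => hst q).1 h3 q (Finset.mem_univ q)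
  refine ⟨fun i => ?_, fun d hd => ?_, fun d hd => ?_⟩
  · have hi : i = 0 ∨ i = 1 ∨ i = 2 := by clear * -; revert i; decide
    rcases hi with rfl | rfl | rfl <;> omega
  · have h3 := heq (G.face.orbit (G.corner 0))
    rw [hsq, show t (G.face.orbit (G.corner 0)) = 0 from if_pos rfl] at h3
    exact Finset.sum_eq_zero_iff.1 h3.symm d (Finset.mem_filter.2 ⟨Finset.mem_univ _, hd⟩)
  · rw [← hsq, ← heq]
    exact if_neg fun h => hd (orbit_eq_orbit.1 h).symm

/-- The colors at the additional vertex. By counting, the label changes along both sides of each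
spoke and of each loop, so that these edges are directed in one direction only; following the labels
around the vertex then determines the colors. -/
theorem IsToroidalWood.colors [Finite D] (hT : G.plus.IsToroidalWood T) :
    ∃ k : ZMod 3, (∀ i, T (Sum.inl (Sum.inr i)) = some (i + k)) ∧
      (∀ i, T (Sum.inr (VDart.spoke i)) = none) ∧
      ((∀ i, T (Sum.inr (VDart.pre i)) = some (i + k + 1) ∧ T (Sum.inr (VDart.post i)) = none) ∨
        ∀ i, T (Sum.inr (VDart.pre i)) = none ∧
          T (Sum.inr (VDart.post i)) = some (i + k - 1)) := by
  have := Fintype.ofFinite D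
  obtain ⟨ℓ, hℓ⟩ := G.plus.exists_isLabeling hT.2.1
  obtain ⟨hhalf, -, -⟩ := IsToroidalWood.changes hT hℓ
  have hle := fun x => hℓ.change_le_one hT.1 (G.plus_opp_ne x)
  have hadd := fun x => hℓ.change_add hT.1 (G.plus_opp_ne x)
  have hone : ∀ i, G.plus.change ℓ (Sum.inl (Sum.inr i)) = 1 ∧
      G.plus.change ℓ (Sum.inr (VDart.spoke i)) = 1 ∧
      G.plus.change ℓ (Sum.inr (VDart.pre i)) = 1 ∧
      G.plus.change ℓ (Sum.inr (VDart.post i)) = 1 := by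
    have hv := sum_outs_vertex hT.2.1
    rw [VDart.sum_eq, ZMod.sum_three, ZMod.sum_three, ZMod.sum_three] at hv
    have h1 : ∀ i, _ := fun i => hadd (Sum.inl (Sum.inr i))
    have h2 : ∀ i, _ := fun i => hadd (Sum.inr (VDart.pre i))
    simp only [plus_opp_inl_inr, plus_opp_pre, hhalf] at h1 h2
    have e1 := h1 0
    have e2 := h1 1
    have e3 := h1 2
    have f1 := h2 0
    have f2 := h2 1
    have f3 := h2 2
    rw [show (0 + 1 : ZMod 3) = 1 by decide] at f1
    rw [show (1 + 1 : ZMod 3) = 2 by decide] at f2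
    rw [show (2 + 1 : ZMod 3) = 0 by decide] at f3
    have a0 := hle (Sum.inl (Sum.inr 0))
    have a1 := hle (Sum.inl (Sum.inr 1))
    have a2 := hle (Sum.inl (Sum.inr 2))
    have b0 := hle (Sum.inr (VDart.spoke 0))
    have b1 := hle (Sum.inr (VDart.spoke 1))
    have b2 := hle (Sum.inr (VDart.spoke 2))
    have c0 := hle (Sum.inr (VDart.pre 0))
    have c1 := hle (Sum.inr (VDart.pre 1))
    have c2 := hle (Sum.inr (VDart.pre 2))
    have d0 := hle (Sum.inr (VDart.post 0))
    have d1 := hle (Sum.inr (VDart.post 1))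
    have d2 := hle (Sum.inr (VDart.post 2))
    intro i
    have hi : i = 0 ∨ i = 1 ∨ i = 2 := by clear * -; revert i; decide
    rcases hi with rfl | rfl | rfl <;> omega
  have hspoke : ∀ i, T (Sum.inr (VDart.spoke i)) = none := by
    intro i
    have h := hadd (Sum.inl (Sum.inr i))
    rw [plus_opp_inl_inr, (hone i).1, (hone i).2.1, hhalf] at h
    exact outs_eq_zero.1 (by omega)
  have hloop : ∀ i, outs T (Sum.inr (VDart.pre i)) + outs T (Sum.inr (VDart.post (i + 1))) = 1 := by
    intro i
    have h := hadd (Sum.inr (VDart.pre i))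
    rw [plus_opp_pre, (hone i).2.2.1, (hone (i + 1)).2.2.2] at h
    omega
  have hcol : ∀ i, ∃ c, T (Sum.inl (Sum.inr i)) = some c := by
    intro i
    refine Option.ne_none_iff_exists'.1 fun h => ?_
    have h' := hhalf i
    rw [outs_of_none h] at h'
    omega
  choose c hc using hcol
  have hlspoke : ∀ i, ℓ (Sum.inr (VDart.spoke i)) = c i := fun i =>
    hℓ.of_enters _ _ ⟨G.plus_opp_ne _, hc i⟩ (hspoke i)
  have hstep : ∀ i, c (i + 1) = c i + 1 := by
    intro i
    have h1 := G.plus.label_face ℓ (Sum.inl (Sum.inr i))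
    have h2 := G.plus.label_face ℓ (Sum.inr (VDart.pre i))
    rw [plus_face_inl_inr, (hone i).1, hℓ.of_out _ _ (hc i)] at h1
    rw [plus_face_pre, hlspoke, (hone i).2.2.1, h1] at h2
    rw [h2]; push_cast; ring
  have hci : ∀ i, c i = i + c 0 := by
    have e0 := hstep 0
    have e1 := hstep 1
    rw [show (0 + 1 : ZMod 3) = 1 by decide] at e0
    rw [show (1 + 1 : ZMod 3) = 2 by decide] at e1
    intro i
    have hi : i = 0 ∨ i = 1 ∨ i = 2 := by clear * -; revert i; decide
    rcases hi with rfl | rfl | rfl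
    · simp
    · rw [e0]; ring
    · rw [e1, e0, show (2 : ZMod 3) = 1 + 1 by decide]; ring
  -- between two consecutive spokes the label increases by one
  have hgap : ∀ i, outs T (Sum.inr (VDart.post i)) + outs T (Sum.inr (VDart.pre (i + 1))) = 1 := by
    intro i
    have h1 := hℓ.label_rot (Sum.inr (VDart.spoke i))
    have h2 := hℓ.label_rot (Sum.inr (VDart.post i))
    have h3 := hℓ.label_rot (Sum.inr (VDart.pre (i + 1)))
    simp only [plus_rot_inr] at h1 h2 h3
    change ℓ (Sum.inr (VDart.post i)) = _ + (outs T (Sum.inr (VDart.post i)) : ℕ) at h1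
    change ℓ (Sum.inr (VDart.pre (i + 1))) = _ + (outs T (Sum.inr (VDart.pre (i + 1))) : ℕ) at h2
    change ℓ (Sum.inr (VDart.spoke (i + 1))) =
      _ + (outs T (Sum.inr (VDart.spoke (i + 1))) : ℕ) at h3
    rw [hlspoke, hstep, outs_of_none (hspoke _), h2, h1, hlspoke, Nat.cast_zero, add_zero,
      add_assoc, add_right_inj] at h3
    have ha := outs_le_one T (Sum.inr (VDart.post i))
    have hb := outs_le_one T (Sum.inr (VDart.pre (i + 1)))
    generalize outs T (Sum.inr (VDart.post i)) = a at *
    generalize outs T (Sum.inr (VDart.pre (i + 1))) = b at *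
    clear * - h3 ha hb
    interval_cases a <;> interval_cases b <;> first | rfl | (revert h3; decide)
  have hconst : ∀ i, outs T (Sum.inr (VDart.post i)) = outs T (Sum.inr (VDart.post 0)) := by
    have h1 : ∀ i, outs T (Sum.inr (VDart.post (i + 1 + 1))) = outs T (Sum.inr (VDart.post i)) :=
      fun i => by
        have := hgap i
        have := hloop (i + 1)
        omega
    have e0 := h1 0
    have e2 := h1 2
    rw [show (0 + 1 + 1 : ZMod 3) = 2 by decide] at e0
    rw [show (2 + 1 + 1 : ZMod 3) = 1 by decide] at e2
    intro i
    have hi : i = 0 ∨ i = 1 ∨ i = 2 := by clear * -; revert i; decide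
    rcases hi with rfl | rfl | rfl
    · rfl
    · rw [e2, e0]
    · exact e0
  have hconst' : ∀ i, outs T (Sum.inr (VDart.pre i)) = 1 - outs T (Sum.inr (VDart.post 0)) := by
    intro i
    have := hloop i
    rw [hconst] at this
    omega
  have hsome : ∀ x, outs T x = 1 → ∃ j, T x = some j := by
    intro x hx
    refine Option.ne_none_iff_exists'.1 fun h => ?_
    rw [outs_of_none h] at hx
    omega
  refine ⟨c 0, fun i => by rw [hc, hci], hspoke, ?_⟩
  have h01 := outs_le_one T (Sum.inr (VDart.post 0))
  interval_cases h : outs T (Sum.inr (VDart.post 0))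
  · left
    intro i
    refine ⟨?_, outs_eq_zero.1 (hconst i)⟩
    obtain ⟨j, hj⟩ := hsome _ (hconst' i)
    have h1 := hℓ.label_rot (Sum.inr (VDart.pre i))
    rw [plus_rot_inr] at h1
    change ℓ (Sum.inr (VDart.spoke i)) = _ + (outs T (Sum.inr (VDart.spoke i)) : ℕ) at h1
    rw [hlspoke, outs_of_none (hspoke i), hℓ.of_out _ _ hj, hci] at h1
    rw [hj, h1]; simp
  · right
    intro i
    refine ⟨outs_eq_zero.1 (hconst' i), ?_⟩
    obtain ⟨j, hj⟩ := hsome _ (hconst i)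
    have h1 := hℓ.rot_of_some (Sum.inr (VDart.spoke i)) j hj
    rw [hlspoke, hci] at h1
    rw [hj, h1]; simp

end

end RootedPlanarMap

/-! ### Simple cycles in a planar map -/

namespace CMap

open Equiv.Perm

variable {D : Type*} (M : CMap D)

/-- The darts `c 0, …, c n` form a closed walk with distinct vertices that does not traverse an edge
in both directions. -/
structure IsSimpleCycle {n : ℕ} (c : Fin (n + 1) → D) : Prop where
  next : ∀ k, M.SameVertex (M.opp (c k)) (c (k + 1))
  vertex_injective : ∀ k l, M.SameVertex (c k) (c l) → k = l
  opp_ne : ∀ k l, M.opp (c k) ≠ c l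

variable {M} {n : ℕ} {c : Fin (n + 1) → D}

theorem IsSimpleCycle.injective (hc : M.IsSimpleCycle c) : Function.Injective c := fun k l h =>
  hc.vertex_injective k l (by rw [h]; exact SameCycle.refl _ _)

theorem eq_zero_of_add_one {β : Type*} {f : Fin (n + 1) → β} (h : ∀ k, f (k + 1) = f k) (k) :
    f k = f 0 := by
  induction k using Fin.induction with
  | zero => rfl
  | succ k ih => rw [← Fin.coeSucc_eq_succ, h, ih]

open Classical in
/-- If a function on the faces takes different values only across the edges of a simple cycle, then
its jump is the same across all these edges. -/
theorem IsSimpleCycle.jump_eq [Finite D] (hc : M.IsSimpleCycle c) {φ : D → ℚ}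
    (hφ : ∀ d, φ (M.face d) = φ d)
    (hφc : ∀ d, d ∉ Set.range c → M.opp d ∉ Set.range c → φ (M.opp d) = φ d) (k : Fin (n + 1)) :
    φ (c k) - φ (M.opp (c k)) = φ (c 0) - φ (M.opp (c 0)) := by
  have := Fintype.ofFinite D
  refine eq_zero_of_add_one (f := fun k => φ (c k) - φ (M.opp (c k))) (fun k => ?_) k
  have h := M.sum_boundary_mul hφ
    (π := fun d => if M.SameVertex (c (k + 1)) d then 1 else 0)
    (fun d => if_congr (by simp only [SameVertex, sameCycle_apply_right]) rfl rfl)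
  have hself : M.SameVertex (c (k + 1)) (c (k + 1)) := SameCycle.refl _ _
  have hprev : M.SameVertex (c (k + 1)) (M.opp (c k)) := SameCycle.symm (hc.next k)
  have hsub : ({c (k + 1), M.opp (c k)} : Finset D) ⊆ Finset.univ := Finset.subset_univ _
  rw [← Finset.sum_subset hsub, Finset.sum_pair (hc.opp_ne k (k + 1)).symm,
    if_pos hself, if_pos hprev, M.opp_opp] at h
  · linarith
  · intro d _ hd
    by_cases hv : M.SameVertex (c (k + 1)) d
    · rw [hφc d, sub_self, zero_mul]
      · rintro ⟨l, rfl⟩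
        rw [← hc.vertex_injective _ _ hv] at hd
        simp at hd
      · rintro ⟨l, hl⟩
        have hl' : d = M.opp (c l) := by rw [hl, M.opp_opp]
        rw [hl'] at hv
        have := hc.vertex_injective _ _ (hv.trans (hc.next l))
        rw [add_left_injective 1 this, hl'] at hd
        simp at hd
    · rw [if_neg hv, mul_zero]

theorem eq_of_no_jump (hconn : M.Connected) {φ : D → ℚ} (hφ : ∀ d, φ (M.face d) = φ d)
    (h : ∀ d, φ (M.opp d) = φ d) (x y : D) : φ x = φ y :=
  hconn.eq_of_invariant (fun d => by rw [← h (M.rot d), ← hφ (M.opp (M.rot d)), face_opp_rot]) h x y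

/-- In a map of genus `0` a simple cycle separates the faces: there is a set `X` of faces that lie
on the left of the darts of the cycle, such that no other edges are on the boundary of `X`. -/
theorem IsSimpleCycle.exists_separation [Finite D] (hc : M.IsSimpleCycle c)
    (hM : M.IsMapOfGenus 0) :
    ∃ X : D → Prop, (∀ d, X (M.face d) ↔ X d) ∧
      (∀ d, d ∉ Set.range c → M.opp d ∉ Set.range c → (X (M.opp d) ↔ X d)) ∧
      ∀ k, X (c k) ∧ ¬ X (M.opp (c k)) := by
  classical
  obtain ⟨hopp, hconn, heuler⟩ := hM
  set W : D → Prop := fun d => ∀ e, M.SameVertex d e → e ∉ Set.range c with hW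
  set E : D → Prop := fun d => d ∉ Set.range c ∧ M.opp d ∉ Set.range c with hE
  have hE' : ∀ d, E (M.opp d) ↔ E d := fun d => by
    simp only [hE, M.opp_opp]; exact and_comm
  have hineq := M.numOrbits_add_le hopp hconn (X := fun _ => True) (W := W) (E := E)
    (fun _ => Iff.rfl) (fun d => by simp only [hW, SameVertex, sameCycle_apply_left]) hE'
    (by
      intro d hd
      refine ⟨hd d (SameCycle.refl _ _), ?_⟩
      rintro ⟨k, hk⟩
      have hd' : d = M.opp (c k) := by rw [hk, M.opp_opp]
      exact hd (c (k + 1)) (by rw [hd']; exact hc.next k) ⟨_, rfl⟩)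
    ⟨c 0, fun h => h _ (SameCycle.refl _ _) ⟨0, rfl⟩⟩
  -- removing the vertices and the edges of the cycle does not change their difference
  have hcard_rot : Nat.card M.Vertices ≤ M.rot.numOrbits W + (n + 1) := by
    have hcov : (Set.univ : Set (Quotient (SameCycle.setoid M.rot))) ⊆
        {q | M.rot.OrbitIn W q} ∪ Set.range fun k => M.rot.orbit (c k) := by
      rintro q -
      by_contra! hq
      simp only [Set.mem_union, Set.mem_ofPred_eq, Set.mem_range, not_or, not_exists] at hq
      refine hq.1 fun x hx e hxe => ?_
      rintro ⟨k, rfl⟩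
      exact hq.2 k ((orbit_eq_orbit.2 hxe).symm.trans hx)
    have h1 := (Set.ncard_le_ncard hcov (Set.toFinite _)).trans (Set.ncard_union_le _ _)
    have h2 : (Set.range fun k => M.rot.orbit (c k)).ncard ≤ n + 1 := by
      rw [← Set.image_univ]
      refine (Set.ncard_image_le (Set.toFinite _)).trans ?_
      rw [Set.ncard_univ, Nat.card_eq_fintype_card, Fintype.card_fin]
    rw [Set.ncard_univ] at h1
    exact h1.trans (Nat.add_le_add_left h2 _)
  have hcard_opp : M.opp.numOrbits E + (n + 1) ≤ Nat.card M.Edges := by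
    have hdisj : Disjoint {q | M.opp.OrbitIn E q} (Set.range fun k => M.opp.orbit (c k)) := by
      rw [Set.disjoint_right]
      rintro _ ⟨k, rfl⟩ h
      exact (h (c k) rfl).1 ⟨k, rfl⟩
    have h1 := Set.ncard_union_eq hdisj (Set.toFinite _) (Set.toFinite _)
    have h2 : (Set.range fun k => M.opp.orbit (c k)).ncard = n + 1 := by
      rw [← Set.image_univ, Set.ncard_image_of_injective, Set.ncard_univ,
        Nat.card_eq_fintype_card, Fintype.card_fin]
      intro k l hkl
      rcases M.sameCycle_opp.1 (orbit_eq_orbit.1 hkl) with h | h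
      · exact hc.injective h.symm
      · exact absurd h.symm (hc.opp_ne k l)
    have h3 := Set.ncard_le_ncard (Set.subset_univ
      ({q | M.opp.OrbitIn E q} ∪ Set.range fun k => M.opp.orbit (c k))) (Set.toFinite _)
    rw [h1, h2, Set.ncard_univ] at h3
    exact h3
  rw [numOrbits_true] at hineq
  change Nat.card M.Faces + _ ≤ _ at hineq
  rw [eulerChar] at heuler
  have hrank : 2 ≤ Module.finrank ℚ (M.constAcross (fun _ => True) E) := by
    push_cast at heuler
    omega
  obtain ⟨φ, hφ, hφn⟩ : ∃ φ ∈ M.constAcross (fun _ => True) E, ¬ ∀ x y, φ x = φ y := by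
    by_contra! hcon
    have hle : M.constAcross (fun _ => True) E ≤ Submodule.span ℚ {fun _ => 1} := by
      intro φ hφ
      refine Submodule.mem_span_singleton.2 ⟨φ (c 0), ?_⟩
      ext x
      simp [hcon φ hφ x (c 0)]
    have h1 := (Submodule.finrank_mono hle).trans (finrank_span_le_card _)
    simp at h1
    omega
  obtain ⟨⟨hφf, -⟩, hφE⟩ := hφ
  have hφc : ∀ d, d ∉ Set.range c → M.opp d ∉ Set.range c → φ (M.opp d) = φ d :=
    fun d h1 h2 => hφE d ⟨h1, h2⟩
  have hjump := hc.jump_eq hφf hφc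
  have h0 : φ (c 0) ≠ φ (M.opp (c 0)) := by
    intro h0
    refine hφn (eq_of_no_jump hconn hφf fun d => ?_)
    by_cases h1 : d ∈ Set.range c
    · obtain ⟨k, rfl⟩ := h1
      have := hjump k
      linarith
    · by_cases h2 : M.opp d ∈ Set.range c
      · obtain ⟨k, hk⟩ := h2
        have := hjump k
        rw [hk, M.opp_opp] at this
        linarith
      · exact hφc d h1 h2
  refine ⟨fun d => φ d = φ (c 0), fun d => by simp only [hφf],
    fun d h1 h2 => by simp only [hφc d h1 h2], fun k => ?_⟩
  have hk := hc.jump_eq (φ := fun d => if φ d = φ (c 0) then 1 else 0)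
    (fun d => by rw [hφf]) (fun d h1 h2 => by rw [hφc d h1 h2]) k
  rw [if_pos (rfl : φ (c 0) = φ (c 0)), if_neg h0.symm] at hk
  split_ifs at hk with h1 h2 h2
  · norm_num at hk
  · exact ⟨h1, h2⟩
  · norm_num at hk
  · norm_num at hk

/-- Either side `X` of a simple cycle is connected: if `W` is the set of vertices surrounded by
`X` and `E` the set of edges with `X` on both sides, then `W` and `X` together have at
most one element more than `E`. -/
theorem IsSimpleCycle.numOrbits_side_le [Finite D] (hc : M.IsSimpleCycle c)
    (hopp : ∀ d, M.opp d ≠ d) (hconn : M.Connected) {X : D → Prop}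
    (hX : ∀ d, X (M.face d) ↔ X d)
    (hXc : ∀ d, d ∉ Set.range c → M.opp d ∉ Set.range c → (X (M.opp d) ↔ X d))
    (hside : ∀ k, X (c k) ↔ ¬ X (M.opp (c k))) :
    M.face.numOrbits X + M.rot.numOrbits (fun d => ∀ e, M.SameVertex d e → X e) ≤
      M.opp.numOrbits (fun d => X d ∧ X (M.opp d)) + 1 := by
  classical
  have hout : ∃ d, ¬ X d := by
    by_cases h : X (c 0)
    · exact ⟨_, (hside 0).1 h⟩
    · exact ⟨_, h⟩
  obtain ⟨d₀, hd₀⟩ := hout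
  have hineq := M.numOrbits_add_le hopp hconn (X := X)
    (W := fun d => ∀ e, M.SameVertex d e → X e) (E := fun d => X d ∧ X (M.opp d)) hX
    (fun d => by simp only [SameVertex, sameCycle_apply_left])
    (fun d => by rw [M.opp_opp]; exact and_comm)
    (fun d hd => ⟨hd d (SameCycle.refl _ _), by
      have h1 := hd (M.face (M.opp d)) (by
        have := M.sameVertex_opp_face (M.opp d)
        rwa [M.opp_opp] at this)
      rwa [hX] at h1⟩)
    ⟨d₀, fun h => hd₀ (h d₀ (SameCycle.refl _ _))⟩
  refine hineq.trans (Nat.add_le_add_left ?_ _)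
  set u : D → ℚ := fun d => if X d then 1 else 0 with hu
  have hle : M.constAcross X (fun d => X d ∧ X (M.opp d)) ≤ Submodule.span ℚ {u} := by
    rintro φ ⟨⟨hφf, hφX⟩, hφE⟩
    have hφc : ∀ d, d ∉ Set.range c → M.opp d ∉ Set.range c → φ (M.opp d) = φ d := by
      intro d h1 h2
      by_cases hd : X d
      · exact hφE d ⟨hd, (hXc d h1 h2).2 hd⟩
      · rw [hφX d hd, hφX _ fun h => hd ((hXc d h1 h2).1 h)]
    have hφj := hc.jump_eq hφf hφc
    have huf : ∀ d, u (M.face d) = u d := fun d => by simp only [hu, hX]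
    have huc : ∀ d, d ∉ Set.range c → M.opp d ∉ Set.range c → u (M.opp d) = u d :=
      fun d h1 h2 => by simp only [hu, hXc d h1 h2]
    have huj := hc.jump_eq huf huc
    have hu0 : u (c 0) - u (M.opp (c 0)) ≠ 0 := by
      have := hside 0
      by_cases h : X (M.opp (c 0)) <;> simp_all
    set r := (φ (c 0) - φ (M.opp (c 0))) / (u (c 0) - u (M.opp (c 0))) with hr
    have hr' : ∀ k, φ (c k) - φ (M.opp (c k)) = r * (u (c k) - u (M.opp (c k))) := by
      intro k
      rw [hφj, huj, hr, div_mul_cancel₀ _ hu0]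
    refine Submodule.mem_span_singleton.2 ⟨r, ?_⟩
    have hconst := eq_of_no_jump hconn (φ := fun d => φ d - r * u d)
      (fun d => by simp only [hφf, huf]) (fun d => by
        by_cases h1 : d ∈ Set.range c
        · obtain ⟨k, rfl⟩ := h1
          have := hr' k
          linarith
        · by_cases h2 : M.opp d ∈ Set.range c
          · obtain ⟨k, hk⟩ := h2
            have := hr' k
            rw [hk, M.opp_opp] at this
            linarith
          · simp only [hφc d h1 h2, huc d h1 h2])
    ext d
    have h1 := hconst d d₀
    simp only [hφX d₀ hd₀, hu, if_neg hd₀] at h1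
    simp only [Pi.smul_apply, smul_eq_mul, hu]
    linarith
  have h1 := (Submodule.finrank_mono hle).trans (finrank_span_le_card _)
  simpa using h1

end CMap

/-! ### Absence of monochromatic cycles in the planar part -/

namespace RootedPlanarMap

open Equiv.Perm CMap

variable {D : Type*} {G : RootedPlanarMap D} {T : (D ⊕ ZMod 3) ⊕ VDart → Option (ZMod 3)}
  {ℓ : (D ⊕ ZMod 3) ⊕ VDart → ZMod 3}

theorem anchor_rot_inv_inl (d : D) :
    G.anchor (G.suspension.rot⁻¹ (Sum.inl d)) = G.face (G.opp d) := by
  rw [face_opp]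
  obtain ⟨e, rfl⟩ := G.rot.surjective d
  rw [← mul_apply G.rot⁻¹, inv_mul_cancel, one_apply]
  by_cases he : ∃ j, e = G.corner j
  · obtain ⟨j, rfl⟩ := he
    rw [← suspension_rot_inr, ← mul_apply G.suspension.rot⁻¹, inv_mul_cancel]
    rfl
  · push Not at he
    rw [← suspension_rot_inl _ _ he, ← mul_apply G.suspension.rot⁻¹, inv_mul_cancel]
    rfl

theorem anchor_rot_inv_inr (j : ZMod 3) :
    G.anchor (G.suspension.rot⁻¹ (Sum.inr j)) = G.corner j := by
  rw [← suspension_rot_corner, ← mul_apply G.suspension.rot⁻¹, inv_mul_cancel]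
  rfl

open Classical in
/-- Let `X` be a set of faces of the planar map whose boundary consists of an `i`-cycle, and which
contains the outer face. The number of its faces and inner vertices exceeds that of its inner edges
by `2`.

Each inner vertex has three outgoing edges, each face of `X` other than the outer face has
three changes of label, and each edge accounts for three outgoing edges and changes. The
contribution of the cycle is found by following the label along the cycle, measured from its value
`i - 1` just after the outgoing edges of color `i`, and cancels. The three half-edges account for
the excess. -/
theorem IsToroidalWood.count_side [Fintype D] (hT : G.plus.IsToroidalWood T)
    (hℓ : G.plus.IsLabeling T ℓ) {i : ZMod 3} {n : ℕ} {c : Fin (n + 1) → D}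
    (hc : G.IsSimpleCycle c) (hcol : ∀ k, T (Sum.inl (Sum.inl (c k))) = some i) {X : D → Prop}
    (hX : ∀ d, X (G.face d) ↔ X d)
    (hXc : ∀ d, d ∉ Set.range c → G.opp d ∉ Set.range c → (X (G.opp d) ↔ X d))
    (hside : (∀ k, X (c k) ∧ ¬ X (G.opp (c k))) ∨ ∀ k, ¬ X (c k) ∧ X (G.opp (c k)))
    (hcorner : X (G.corner 0)) :
    G.face.numOrbits X + G.rot.numOrbits (fun d => ∀ e, G.SameVertex d e → X e) =
      G.opp.numOrbits (fun d => X d ∧ X (G.opp d)) + 2 := by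
  obtain ⟨hhalf, houter, hinner⟩ := IsToroidalWood.changes hT hℓ
  set W : D → Prop := fun d => ∀ e, G.SameVertex d e → X e with hW
  set δ : D → ℤ := fun d => (G.plus.change ℓ (Sum.inl (Sum.inl d)) : ℤ) with hδ
  set o : D → ℤ := fun d => (outs T (Sum.inl (Sum.inl d)) : ℤ) with ho
  set a : D → ℤ := fun d => if X d then 1 else 0 with ha
  set C : D → ℤ := fun d => if d ∈ Set.range c then 1 else 0 with hC
  have ha1 : ∀ d, X d → a d = 1 := fun d h => if_pos h
  have ha0 : ∀ d, ¬ X d → a d = 0 := fun d h => if_neg h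
  have hC1 : ∀ d, d ∈ Set.range c → C d = 1 := fun d h => if_pos h
  have hC0 : ∀ d, d ∉ Set.range c → C d = 0 := fun d h => if_neg h
  have hcorner' : ∀ j, X (G.corner j) := fun j =>
    ((G.sameCycle_face_corner j).iff_of_invariant hX).1 hcorner
  -- the faces
  have hF : ∑ d, a d * δ d + 3 = G.face.numOrbits X * 3 := by
    have h := sum_eq_numOrbits_mul hX (fun d => δ d + if d = G.corner 0 then 3 else 0) 3 (by
      intro d _
      rw [Finset.sum_add_distrib, Finset.sum_ite_eq' (Finset.univ.filter _)]
      by_cases hd : G.face.SameCycle (G.corner 0) d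
      · rw [if_pos (by simpa using hd.symm), Finset.sum_eq_zero, zero_add]
        intro y hy
        simp only [hδ]
        rw [houter y (hd.trans (by simpa using hy))]
        rfl
      · rw [if_neg (by simpa using fun h => hd (SameCycle.symm h)), add_zero]
        simp only [hδ]
        exact_mod_cast hinner d hd)
    rw [← h, Finset.sum_add_distrib,
      Finset.sum_ite_eq' (Finset.univ.filter _), if_pos (by simpa using hcorner),
      Finset.sum_filter]
    simp only [ha, ite_mul, one_mul, zero_mul]
  -- the edges
  have hadd : ∀ d, δ d + δ (G.opp d) + (o d + o (G.opp d)) = 3 := by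
    intro d
    have h := hℓ.change_add hT.1 (G.plus_opp_ne (Sum.inl (Sum.inl d)))
    rw [plus_opp_inl_inl] at h
    simp only [hδ, ho]
    exact_mod_cast h
  have hE : ∑ d, a d * a (G.opp d) * (δ d + o d) =
      G.opp.numOrbits (fun d => X d ∧ X (G.opp d)) * 3 := by
    rw [← G.sum_edges G.opp_ne (E := fun d => X d ∧ X (G.opp d))
      (fun d => by rw [G.opp_opp]; exact and_comm) (fun d => δ d + o d) 3
      (fun d _ => by have := hadd d; linarith), Finset.sum_filter]
    refine Finset.sum_congr rfl fun d _ => ?_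
    by_cases h1 : X d <;> by_cases h2 : X (G.opp d) <;> simp [ha, h1, h2]
  -- the vertices
  have hV := sum_color hT.2.1 i (W := W) fun d => by
    simp only [hW, SameVertex, sameCycle_apply_left]
  have hXW : ∀ d, (∀ e, G.SameVertex d e → e ∉ Set.range c) → X d → W d := by
    intro d hd hXd e hde
    have h := hde.iff_of_invariant (p := fun e => G.SameVertex d e ∧ X e) (fun e => by
      simp only [SameVertex, sameCycle_apply_right]
      refine and_congr_right fun he => ?_
      have h1 := hXc (G.rot e) (hd _ (sameCycle_apply_right.2 he)) (by
        rintro ⟨k, hk⟩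
        refine hd (c (k + 1)) ?_ ⟨_, rfl⟩
        refine (sameCycle_apply_right.2 he).trans ?_
        have := hc.next k
        rwa [hk, G.opp_opp] at this)
      rw [← h1, ← hX, face_opp_rot])
    exact (h.1 ⟨SameCycle.refl _ _, hXd⟩).2
  have hcW : ∀ k, ¬ W (c k) := by
    intro k hk
    rcases hside with h | h
    · refine (h (k - 1)).2 (hk _ ?_)
      have := hc.next (k - 1)
      rw [sub_add_cancel] at this
      exact SameCycle.symm this
    · exact (h k).1 (hk _ (SameCycle.refl _ _))
  have hVX : ∑ x : D ⊕ ZMod 3, a (G.anchor x) * (if T (Sum.inl x) = some i then 1 else 0) =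
      G.rot.numOrbits W + ∑ d, C d * a d := by
    have hsum : ∑ d, C d * a d =
        ∑ x : D ⊕ ZMod 3, Sum.elim (fun d => C d * a d) (fun _ => 0) x := by
      rw [Fintype.sum_sum_type]; simp
    rw [← hV, Finset.sum_filter, hsum, ← Finset.sum_add_distrib]
    refine Finset.sum_congr rfl fun x _ => ?_
    by_cases hx : T (Sum.inl x) = some i
    · rw [if_pos hx, mul_one]
      by_cases hw : W (G.anchor x)
      · rw [if_pos hw]
        have hXx : X (G.anchor x) := hw _ (SameCycle.refl _ _)
        rcases x with d | j
        · have : d ∉ Set.range c := by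
            rintro ⟨k, rfl⟩
            exact hcW k hw
          have hXd : X d := hXx
          simp [hC0 _ this, anchor, ha1 _ hXd]
        · simp only [ha, if_pos hXx, Sum.elim_inr, add_zero]
      · rw [if_neg hw, zero_add]
        by_cases hXx : X (G.anchor x)
        · have hex : ∃ k, G.SameVertex (G.anchor x) (c k) := by
            by_contra! hno
            exact hw (hXW _ (by rintro e he ⟨k, rfl⟩; exact hno k he) hXx)
          obtain ⟨k, hk⟩ := hex
          have hxk : Sum.inl x = Sum.inl (Sum.inl (c k)) :=
            SchnyderAt.out_unique _ (hT.2.1 _) hx (hcol k)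
              (G.plus_sameVertex_inl.2 (G.suspension_sameVertex.2 hk))
          obtain rfl := Sum.inl_injective hxk
          simp [hC1 _ ⟨k, rfl⟩, anchor]
        · rcases x with d | j
          · have hXd : ¬ X d := hXx
            simp [anchor, ha0 _ hXd]
          · simp only [ha, if_neg hXx, Sum.elim_inr]
    · rcases x with d | j
      · have : d ∉ Set.range c := by
          rintro ⟨k, rfl⟩
          exact hx (hcol k)
        simp [hx, hC0 _ this]
      · simp [hx]
  -- the label, measured from `i - 1`, and its sum along the boundary of `X`
  set lam : D ⊕ ZMod 3 → ℤ := fun x => ((ℓ (Sum.inl x) - (i - 1)).val : ℤ) with hlam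
  have hlam_rot : ∀ x, lam (G.suspension.rot x) - lam x =
      outs T (Sum.inl (G.suspension.rot x)) -
        3 * if T (Sum.inl (G.suspension.rot x)) = some i then 1 else 0 := by
    intro x
    simp only [hlam]
    rcases h : T (Sum.inl (G.suspension.rot x)) with _ | j
    · have h1 := hℓ.rot_of_none (Sum.inl x) h
      rw [plus_rot_inl] at h1
      rw [h1, outs_of_none h]; simp
    · have h1 := hℓ.rot_of_some (Sum.inl x) j h
      rw [h1, hℓ.of_out _ j h, outs_of_some h]
      simp only [Option.some.injEq]
      clear * -
      revert i j
      decide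
  have hparts : ∑ x : D ⊕ ZMod 3, a (G.anchor x) * (outs T (Sum.inl x) -
      3 * if T (Sum.inl x) = some i then 1 else 0) =
      ∑ d, (a (G.opp d) - a d) * lam (G.suspension.rot⁻¹ (Sum.inl d)) := by
    have h1 : ∑ d, (a (G.opp d) - a d) * lam (G.suspension.rot⁻¹ (Sum.inl d)) =
        ∑ y : D ⊕ ZMod 3, (a (G.anchor (G.suspension.rot⁻¹ y)) - a (G.anchor y)) *
          lam (G.suspension.rot⁻¹ y) := by
      rw [Fintype.sum_sum_type]
      have haf : ∀ d, a (G.face d) = a d := fun d => by simp only [ha, hX]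
      have hl : ∀ d, G.anchor (Sum.inl d) = d := fun _ => rfl
      have hr : ∀ j, G.anchor (Sum.inr j) = G.corner j := fun _ => rfl
      simp only [anchor_rot_inv_inl, anchor_rot_inv_inr, haf, hl, hr, sub_self, zero_mul,
        Finset.sum_const_zero, add_zero]
    have h2 : ∀ x, (outs T (Sum.inl x) : ℤ) - 3 * (if T (Sum.inl x) = some i then 1 else 0) =
        lam x - lam (G.suspension.rot⁻¹ x) := by
      intro x
      have := hlam_rot (G.suspension.rot⁻¹ x)
      rw [← mul_apply G.suspension.rot, mul_inv_cancel, one_apply] at this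
      exact this.symm
    have h3 : ∑ x, a (G.anchor (G.suspension.rot⁻¹ x)) * lam (G.suspension.rot⁻¹ x) =
        ∑ x, a (G.anchor x) * lam x :=
      Equiv.sum_comp (G.suspension.rot⁻¹) fun x => a (G.anchor x) * lam x
    rw [h1]
    simp only [h2]
    simp only [mul_sub, sub_mul, Finset.sum_sub_distrib, h3]
  have hlamC : ∀ d, d ∈ Set.range c → lam (G.suspension.rot⁻¹ (Sum.inl (G.opp d))) -
      lam (G.suspension.rot⁻¹ (Sum.inl d)) = δ d - 2 := by
    rintro _ ⟨k, rfl⟩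
    have h1 : ℓ (Sum.inl (G.suspension.rot⁻¹ (Sum.inl (c k)))) = i + 1 := by
      refine hℓ.rot_of_some _ i ?_
      rw [plus_rot_inl, ← mul_apply G.suspension.rot, mul_inv_cancel, one_apply, hcol]
    have h2 : ℓ (Sum.inl (G.suspension.rot⁻¹ (Sum.inl (G.opp (c k))))) =
        i - 1 + G.plus.change ℓ (Sum.inl (Sum.inl (c k))) := by
      rw [← hℓ.of_out _ i (hcol k), ← label_face]
      rfl
    have h3 := hℓ.change_le_one hT.1 (G.plus_opp_ne (Sum.inl (Sum.inl (c k))))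
    simp only [hlam, hδ, h1, h2]
    generalize G.plus.change ℓ (Sum.inl (Sum.inl (c k))) = m at *
    clear * - h3
    interval_cases m <;> (revert i; decide)
  have hodd : ∀ f : D → ℤ, ∑ d, C (G.opp d) * f d = ∑ d, C d * f (G.opp d) := by
    intro f
    rw [← Equiv.sum_comp G.opp]
    exact Finset.sum_congr rfl fun d _ => by rw [G.opp_opp]
  have hbdry : ∑ d, (C (G.opp d) - C d) * lam (G.suspension.rot⁻¹ (Sum.inl d)) =
      ∑ d, C d * δ d - 2 * ∑ d, C d := by
    simp only [sub_mul, Finset.sum_sub_distrib]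
    rw [hodd fun d => lam (G.suspension.rot⁻¹ (Sum.inl d)), ← Finset.sum_sub_distrib,
      Finset.mul_sum, ← Finset.sum_sub_distrib]
    refine Finset.sum_congr rfl fun d _ => ?_
    by_cases hd : d ∈ Set.range c
    · have := hlamC d hd
      rw [hC1 d hd]
      linarith
    · rw [hC0 d hd]; ring
  have hCo : ∀ d, C d * o d = C d := by
    intro d
    by_cases hd : d ∈ Set.range c
    · obtain ⟨k, rfl⟩ := hd
      simp only [ho, outs_of_some (hcol k)]; simp
    · rw [hC0 d hd, zero_mul]
  have htot : ∑ x : D ⊕ ZMod 3, a (G.anchor x) * (outs T (Sum.inl x) : ℤ) =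
      ∑ d, a d * o d + 3 := by
    rw [Fintype.sum_sum_type]
    congr 1
    simp [anchor, ha, hcorner', hhalf]
  have hsplit : ∑ x : D ⊕ ZMod 3, a (G.anchor x) * (outs T (Sum.inl x) -
      3 * if T (Sum.inl x) = some i then 1 else 0) =
      ∑ d, a d * o d + 3 - 3 * (G.rot.numOrbits W + ∑ d, C d * a d) := by
    rw [← htot, ← hVX, Finset.mul_sum, ← Finset.sum_sub_distrib]
    exact Finset.sum_congr rfl fun x _ => by ring
  rw [hparts] at hsplit
  have hEX : ∑ d, a d * δ d + ∑ d, a d * o d =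
      ∑ d, a d * a (G.opp d) * (δ d + o d) + ∑ d, a d * (1 - a (G.opp d)) * (δ d + o d) := by
    rw [← Finset.sum_add_distrib, ← Finset.sum_add_distrib]
    exact Finset.sum_congr rfl fun d _ => by ring
  have hmem : ∀ d, d ∈ Set.range c → G.opp d ∉ Set.range c := by
    rintro _ ⟨k, rfl⟩ ⟨l, hl⟩
    exact hc.opp_ne k l hl.symm
  have hmem' : ∀ d, G.opp d ∈ Set.range c → ∃ k, d = G.opp (c k) := by
    rintro d ⟨k, hk⟩
    exact ⟨k, by rw [hk, G.opp_opp]⟩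
  rcases hside with hs | hs
  · have hac : ∀ d, a (G.opp d) - a d = C (G.opp d) - C d ∧ a d * (1 - a (G.opp d)) = C d ∧
        C d * a d = C d := by
      intro d
      by_cases h1 : d ∈ Set.range c
      · have h2 := hmem d h1
        obtain ⟨k, rfl⟩ := h1
        simp [hC0 _ h2, hC1 _ ⟨k, rfl⟩, ha, hs k]
      · by_cases h2 : G.opp d ∈ Set.range c
        · obtain ⟨k, rfl⟩ := hmem' d h2
          simp [hC0 _ h1, hC1 (c k) ⟨k, rfl⟩, ha, hs k, G.opp_opp]
        · have := hXc d h1 h2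
          by_cases hXd : X d <;> simp [ha, hC0 _ h1, hC0 _ h2, this, hXd]
    simp only [(hac _).1, (hac _).2.2] at hsplit
    simp only [(hac _).2.1, mul_add, hCo, Finset.sum_add_distrib] at hEX
    simp only [mul_add, Finset.sum_add_distrib] at hE
    omega
  · have hac : ∀ d, a (G.opp d) - a d = -(C (G.opp d) - C d) ∧
        a d * (1 - a (G.opp d)) = C (G.opp d) ∧ C d * a d = 0 := by
      intro d
      by_cases h1 : d ∈ Set.range c
      · have h2 := hmem d h1
        obtain ⟨k, rfl⟩ := h1
        simp [hC0 _ h2, hC1 _ ⟨k, rfl⟩, ha, hs k]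
      · by_cases h2 : G.opp d ∈ Set.range c
        · obtain ⟨k, rfl⟩ := hmem' d h2
          simp [hC0 _ h1, hC1 (c k) ⟨k, rfl⟩, ha, hs k, G.opp_opp]
        · have := hXc d h1 h2
          by_cases hXd : X d <;> simp [ha, hC0 _ h1, hC0 _ h2, this, hXd]
    have hopp : ∑ d, C (G.opp d) * (δ d + o d) = 2 * ∑ d, C d - ∑ d, C d * δ d := by
      rw [hodd fun d => δ d + o d, Finset.mul_sum, ← Finset.sum_sub_distrib]
      refine Finset.sum_congr rfl fun d _ => ?_
      have h1 := hCo d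
      have h2 : δ (G.opp d) + o (G.opp d) = 3 - δ d - o d := by have := hadd d; linarith
      rw [h2]
      linear_combination (-1 : ℤ) * h1
    simp only [(hac _).1, (hac _).2.2, neg_mul, Finset.sum_neg_distrib] at hsplit
    simp only [(hac _).2.1, hopp] at hEX
    rw [hE] at hEX
    simp only [Finset.sum_const_zero, add_zero] at hsplit
    omega

/-- A toroidal Schnyder wood has no monochromatic cycle avoiding the additional vertex: such a cycle
would separate the planar map, and counting on its side that contains the outer face would give
one unit more than is possible for a connected side. -/
theorem IsToroidalWood.not_isMonoCycle [Finite D] (hT : G.plus.IsToroidalWood T) {i : ZMod 3}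
    {n : ℕ} (c : Fin (n + 1) → D ⊕ ZMod 3) :
    ¬ G.suspension.IsMonoCycle (fun x => T (Sum.inl x)) i c := by
  intro hmono
  have := Fintype.ofFinite D
  obtain ⟨ℓ, hℓ⟩ := G.plus.exists_isLabeling hT.2.1
  have hinl : ∀ k, ∃ d, c k = Sum.inl d := by
    intro k
    rcases h : c k with d | j
    · exact ⟨d, rfl⟩
    · exact absurd (by rw [h]; rfl) (hmono.1 k).1
  choose c' hc' using hinl
  have hcol : ∀ k, T (Sum.inl (Sum.inl (c' k))) = some i := fun k => by
    rw [← hc']; exact (hmono.1 k).2.1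
  have hc : G.IsSimpleCycle c' := by
    refine ⟨fun k => ?_, fun k l hkl => ?_, fun k l hkl => ?_⟩
    · have h := (hmono.1 k).2.2
      rw [hc', hc', suspension_opp_inl, suspension_sameVertex] at h
      exact h
    · refine hmono.2 k l ?_
      rw [hc', hc', suspension_sameVertex]
      exact hkl
    · refine (hT.1 (Sum.inl (Sum.inl (c' k)))).2 (G.plus_opp_ne _) (by simp [hcol]) ?_
      rw [plus_opp_inl_inl, hkl, hcol, hcol]
  obtain ⟨X, hX, hXc, hXs⟩ := hc.exists_separation G.genus_zero
  by_cases h0 : X (G.corner 0)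
  · have h1 := IsToroidalWood.count_side hT hℓ hc hcol hX hXc (Or.inl hXs) h0
    have h2 := hc.numOrbits_side_le G.opp_ne G.connected hX hXc
      (fun k => by simp [hXs k])
    omega
  · have hX' : ∀ d, ¬ X (G.face d) ↔ ¬ X d := fun d => not_congr (hX d)
    have hXc' : ∀ d, d ∉ Set.range c' → G.opp d ∉ Set.range c' → (¬ X (G.opp d) ↔ ¬ X d) :=
      fun d h1 h2 => not_congr (hXc d h1 h2)
    have h1 := IsToroidalWood.count_side hT hℓ hc hcol (X := fun d => ¬ X d) hX' hXc'
      (Or.inr fun k => by simp [hXs k]) h0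
    have h2 := hc.numOrbits_side_le G.opp_ne G.connected (X := fun d => ¬ X d) hX' hXc'
      (fun k => by simp [hXs k])
    omega

end RootedPlanarMap

/-! ### Restricting toroidal woods and extending planar woods -/

namespace RootedPlanarMap

open Equiv.Perm CMap

variable {D : Type*} {G : RootedPlanarMap D} {T : (D ⊕ ZMod 3) ⊕ VDart → Option (ZMod 3)}

/-- At the vertices of the planar map, the Schnyder property means the same in the toroidal map and
in the suspension, provided that no spoke enters such a vertex. -/
theorem plus_schnyderAt_inl (hsp : ∀ i, T (Sum.inr (VDart.spoke i)) = none) (x : D ⊕ ZMod 3) :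
    G.plus.SchnyderAt T (Sum.inl x) ↔ G.suspension.SchnyderAt (fun y => T (Sum.inl y)) x := by
  have hent : ∀ y i, G.plus.Enters T (Sum.inl y) i ↔
      G.suspension.Enters (fun y => T (Sum.inl y)) y i := by
    rintro (d | j) i
    · simp only [Enters, plus_opp_inl_inl, suspension_opp_inl, ne_eq, Sum.inl.injEq]
    · simp only [Enters, plus_opp_inl_inr, suspension_opp_inr, hsp, reduceCtorEq, and_false,
        ne_eq, not_true, false_and]
  constructor
  · rintro ⟨e, h1, h2, h3, h4⟩
    have hinl : ∀ i, ∃ y, e i = Sum.inl y := by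
      intro i
      rcases he : e i with y | y
      · exact ⟨y, rfl⟩
      · have := (h1 i).1
        rw [he] at this
        exact absurd this (G.not_plus_sameVertex_inl_inr _ _)
    choose f hf using hinl
    simp only [hf, plus_sameVertex_inl, plus_inSector_inl] at h1 h2 h3 h4
    refine ⟨f, h1, fun i d hd hc => ?_, h3, fun i d hd hi => ?_⟩
    · exact Sum.inl_injective (h2 i _ (G.plus_sameVertex_inl.2 hd) hc)
    · exact G.plus_inSector_inl.1 (h4 i _ (G.plus_sameVertex_inl.2 hd) ((hent d i).2 hi))
  · rintro ⟨e, h1, h2, h3, h4⟩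
    refine ⟨fun i => Sum.inl (e i), fun i => ⟨G.plus_sameVertex_inl.2 (h1 i).1, (h1 i).2⟩, ?_,
      G.plus_inSector_inl.2 h3, ?_⟩
    · rintro i (d | y) hd hc
      · rw [h2 i d (G.plus_sameVertex_inl.1 hd) hc]
      · exact absurd hd (G.not_plus_sameVertex_inl_inr _ _)
    · rintro i (d | y) hd hi
      · exact G.plus_inSector_inl.2 (h4 i d (G.plus_sameVertex_inl.1 hd) ((hent d i).1 hi))
      · exact absurd hd (G.not_plus_sameVertex_inl_inr _ _)

/-- The restriction of a toroidal Schnyder wood, with the colors normalized at the half-edges, is a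
planar Schnyder wood. -/
theorem IsToroidalWood.isPlanarWood [Finite D] (hT : G.plus.IsToroidalWood T) {k : ZMod 3}
    (hk : ∀ i, T (Sum.inl (Sum.inr i)) = some (i + k))
    (hsp : ∀ i, T (Sum.inr (VDart.spoke i)) = none) :
    G.IsPlanarWood fun x => (T (Sum.inl x)).map (· + -k) := by
  refine ⟨?_, fun x => ?_, fun i => by simp [hk], fun i n c hc => ?_⟩
  · rintro (d | i)
    · have h := hT.1 (Sum.inl (Sum.inl d))
      rw [plus_opp_inl_inl] at h
      rw [suspension_opp_inl]
      simp only [ne_eq, Option.map_eq_none_iff]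
      refine ⟨h.1, fun _ h1 h2 => ?_⟩
      exact h.2 (fun h' => G.opp_ne d (Sum.inl_injective (Sum.inl_injective h'))) h1
        (Option.map_injective (add_left_injective _) h2)
    · rw [suspension_opp_inr]
      simp [hk]
  · exact SchnyderAt.shift _ ((plus_schnyderAt_inl hsp x).1 (hT.2.1 _)) (-k)
  · refine IsToroidalWood.not_isMonoCycle hT (i := i + k) c
      ⟨fun l => ⟨(hc.1 l).1, ?_, (hc.1 l).2.2⟩, hc.2⟩
    obtain ⟨j, hj, hji⟩ := Option.map_eq_some_iff.1 (hc.1 l).2.1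
    simp only at hj ⊢
    rw [hj, ← hji]; simp

/-- The extension of a coloring of the suspension to the toroidal map: all colors are increased by
`k`, the spokes are directed towards the additional vertex, and the loops leave it through the darts
`pre i` or through the darts `post i`, according to `o`. -/
def extendColoring (S : D ⊕ ZMod 3 → Option (ZMod 3)) (k : ZMod 3) (o : Bool) :
    (D ⊕ ZMod 3) ⊕ VDart → Option (ZMod 3)
  | Sum.inl x => (S x).map (· + k)
  | Sum.inr (VDart.spoke _) => none
  | Sum.inr (VDart.pre i) => if o then some (i + k + 1) else none
  | Sum.inr (VDart.post i) => if o then none else some (i + k - 1)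

theorem plus_inSector_inr {x z y : VDart} (k n : ℕ) (hkn : k ≤ n) (hk : (VDart.rot ^ k) x = y)
    (hn : (VDart.rot ^ n) x = z) (hlt : ∀ j < n, (VDart.rot ^ j) x ≠ z) :
    G.plus.InSector (Sum.inr x) (Sum.inr z) (Sum.inr y) := by
  refine ⟨k, n, hkn, ?_, ?_, fun j hj => ?_⟩
  · rw [plus_rot_pow_inr, hk]
  · rw [plus_rot_pow_inr, hn]
  · rw [plus_rot_pow_inr]
    exact fun h => hlt j hj (Sum.inr_injective h)

theorem VDart.rot_pre (i : ZMod 3) : VDart.rot (VDart.pre i) = VDart.spoke i := rfl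

theorem VDart.rot_spoke (i : ZMod 3) : VDart.rot (VDart.spoke i) = VDart.post i := rfl

theorem VDart.rot_post (i : ZMod 3) : VDart.rot (VDart.post i) = VDart.pre (i + 1) := rfl

/-- The Schnyder property at the additional vertex. The nine darts `pre j`, `spoke j`, `post j`
follow each other in the order of `j`; the outgoing edge of color `i` is `post (i - k + 1)` or
`pre (i - k - 1)`, and between two consecutive outgoing edges there are a spoke and the entering end
of a loop. -/
theorem extendColoring_schnyderAt_inr {S : D ⊕ ZMod 3 → Option (ZMod 3)}
    (hS : ∀ i, S (Sum.inr i) = some i) (k : ZMod 3) (o : Bool) (x : VDart) :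
    G.plus.SchnyderAt (extendColoring S k o) (Sum.inr x) := by
  have hpow : ∀ y, (VDart.rot ^ 0) y = y ∧ (VDart.rot ^ 1) y = VDart.rot y ∧
      (VDart.rot ^ 2) y = VDart.rot (VDart.rot y) ∧
      (VDart.rot ^ 3) y = VDart.rot (VDart.rot (VDart.rot y)) ∧
      (VDart.rot ^ 4) y = VDart.rot (VDart.rot (VDart.rot (VDart.rot y))) ∧
      (VDart.rot ^ 5) y = VDart.rot (VDart.rot (VDart.rot (VDart.rot (VDart.rot y)))) ∧
      (VDart.rot ^ 6) y = VDart.rot (VDart.rot (VDart.rot (VDart.rot (VDart.rot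
        (VDart.rot y))))) := fun y => ⟨rfl, rfl, rfl, rfl, rfl, rfl, rfl⟩
  have h11 : (1 + 1 : ZMod 3) ≠ 0 := by decide
  have h1 : (1 : ZMod 3) ≠ 0 := by decide
  cases o
  · refine ⟨fun i => Sum.inr (VDart.post (i - k + 1)), fun i => ⟨G.plus_sameVertex_inr _ _, ?_⟩,
      ?_, ?_, ?_⟩
    · simp [extendColoring]; ring
    · rintro i (d | (j | j | j)) hd hc
      · exact absurd (SameCycle.symm hd) (G.not_plus_sameVertex_inl_inr _ _)
      · simp [extendColoring] at hc
      · simp [extendColoring] at hc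
      · simp only [extendColoring, Bool.false_eq_true, if_false, Option.some.injEq] at hc
        rw [← hc]
        congr 2; ring
    · beta_reduce
      rw [show (1 - k + 1 : ZMod 3) = 0 - k + 1 + 1 by ring,
        show (2 - k + 1 : ZMod 3) = 0 - k + 1 + 1 + 1 by
          rw [show (2 : ZMod 3) = 1 + 1 by decide]; ring]
      generalize (0 - k + 1 : ZMod 3) = a
      refine plus_inSector_inr 3 6 (by omega) ?_ ?_ ?_
      · rfl
      · rfl
      · intro j hj
        interval_cases j <;>
          simp [hpow, VDart.rot_pre, VDart.rot_spoke, VDart.rot_post, add_assoc, h1, h11]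
    · have hsec : ∀ a b y, b = a + 1 → (y = VDart.pre (a + 1) ∨ y = VDart.spoke (a + 1)) →
          G.plus.InSector (Sum.inr (VDart.post a)) (Sum.inr (VDart.post b)) (Sum.inr y) := by
        rintro a _ y rfl (rfl | rfl)
        · refine plus_inSector_inr 1 3 (by omega) ?_ ?_ ?_
          · rfl
          · rfl
          · intro j hj
            interval_cases j <;> simp [hpow, VDart.rot_pre, VDart.rot_post]
        · refine plus_inSector_inr 2 3 (by omega) ?_ ?_ ?_
          · rfl
          · rfl
          · intro j hj
            interval_cases j <;> simp [hpow, VDart.rot_pre, VDart.rot_post]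
      rintro i (d | (j | j | j)) hd ⟨-, hi⟩
      · exact absurd (SameCycle.symm hd) (G.not_plus_sameVertex_inl_inr _ _)
      · simp only [plus_opp_spoke, extendColoring, hS, Option.map_some, Option.some.injEq] at hi
        subst hi
        refine hsec _ _ _ ?_ (Or.inr (congrArg _ ?_)) <;> clear * - <;> revert j k <;> decide
      · simp only [plus_opp_pre, extendColoring, Bool.false_eq_true, if_false,
          Option.some.injEq] at hi
        subst hi
        refine hsec _ _ _ ?_ (Or.inl (congrArg _ ?_)) <;> clear * - <;> revert j k <;> decide
      · simp [plus_opp_post, extendColoring] at hi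
  · refine ⟨fun i => Sum.inr (VDart.pre (i - k - 1)), fun i => ⟨G.plus_sameVertex_inr _ _, ?_⟩,
      ?_, ?_, ?_⟩
    · simp [extendColoring]; ring
    · rintro i (d | (j | j | j)) hd hc
      · exact absurd (SameCycle.symm hd) (G.not_plus_sameVertex_inl_inr _ _)
      · simp [extendColoring] at hc
      · simp only [extendColoring, if_true, Option.some.injEq] at hc
        rw [← hc]
        congr 2; ring
      · simp [extendColoring] at hc
    · beta_reduce
      rw [show (1 - k - 1 : ZMod 3) = 0 - k - 1 + 1 by ring,
        show (2 - k - 1 : ZMod 3) = 0 - k - 1 + 1 + 1 by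
          rw [show (2 : ZMod 3) = 1 + 1 by decide]; ring]
      generalize (0 - k - 1 : ZMod 3) = a
      refine plus_inSector_inr 3 6 (by omega) ?_ ?_ ?_
      · rfl
      · rfl
      · intro j hj
        interval_cases j <;>
          simp [hpow, VDart.rot_pre, VDart.rot_spoke, VDart.rot_post, add_assoc, h1, h11]
    · have hsec : ∀ a b y, b = a + 1 → (y = VDart.spoke a ∨ y = VDart.post a) →
          G.plus.InSector (Sum.inr (VDart.pre a)) (Sum.inr (VDart.pre b)) (Sum.inr y) := by
        rintro a _ y rfl (rfl | rfl)
        · refine plus_inSector_inr 1 3 (by omega) ?_ ?_ ?_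
          · rfl
          · rfl
          · intro j hj
            interval_cases j <;> simp [hpow, VDart.rot_pre, VDart.rot_spoke]
        · refine plus_inSector_inr 2 3 (by omega) ?_ ?_ ?_
          · rfl
          · rfl
          · intro j hj
            interval_cases j <;> simp [hpow, VDart.rot_pre, VDart.rot_spoke]
      rintro i (d | (j | j | j)) hd ⟨-, hi⟩
      · exact absurd (SameCycle.symm hd) (G.not_plus_sameVertex_inl_inr _ _)
      · simp only [plus_opp_spoke, extendColoring, hS, Option.map_some, Option.some.injEq] at hi
        subst hi
        refine hsec _ _ _ ?_ (Or.inl (congrArg _ ?_)) <;> clear * - <;> revert j k <;> decide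
      · simp [plus_opp_pre, extendColoring] at hi
      · simp only [plus_opp_post, extendColoring, if_true, Option.some.injEq] at hi
        subst hi
        refine hsec _ _ _ ?_ (Or.inr (congrArg _ ?_)) <;> clear * - <;> revert j k <;> decide

/-- Every extension of a planar Schnyder wood is a toroidal Schnyder wood: there being no
monochromatic cycles in the planar part, all monochromatic cycles pass through the additional
vertex, where there is a loop of each color. -/
theorem extendColoring_isToroidalWood [Finite D] {S : D ⊕ ZMod 3 → Option (ZMod 3)}
    (hS : G.IsPlanarWood S) (k : ZMod 3) (o : Bool) :
    G.plus.IsToroidalWood (extendColoring S k o) := by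
  obtain ⟨ho, hs, hhalf, hcyc⟩ := hS
  have hsch : ∀ x, G.plus.SchnyderAt (extendColoring S k o) x := by
    rintro (x | x)
    · exact (plus_schnyderAt_inl (fun i => rfl) x).2 (SchnyderAt.shift _ (hs x) k)
    · exact extendColoring_schnyderAt_inr hhalf k o x
  have hor : G.plus.IsOrientedColoring (extendColoring S k o) := by
    rintro ((d | i) | (i | i | i))
    · have h := ho (Sum.inl d)
      rw [suspension_opp_inl] at h
      rw [plus_opp_inl_inl]
      simp only [extendColoring, ne_eq, Option.map_eq_none_iff]
      refine ⟨h.1, fun h1 h2 h3 => ?_⟩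
      exact h.2 (fun h' => G.opp_ne d (Sum.inl_injective h')) h2
        (Option.map_injective (add_left_injective _) h3)
    · simp [plus_opp_inl_inr, extendColoring, hhalf]
    · simp [plus_opp_spoke, extendColoring, hhalf]
    · cases o <;> simp [plus_opp_pre, extendColoring]
    · cases o <;> simp [plus_opp_post, extendColoring]
  have hvertex : ∀ (i : ZMod 3) (n : ℕ) (c : Fin (n + 1) → (D ⊕ ZMod 3) ⊕ VDart),
      G.plus.IsMonoCycle (extendColoring S k o) i c → ∃ l y, c l = Sum.inr y := by
    intro i n c hc
    by_contra! hno
    have hinl : ∀ l, ∃ d, c l = Sum.inl (Sum.inl d) := by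
      intro l
      have hinl' : ∀ l, ∃ x, c l = Sum.inl x := fun l => by
        rcases h : c l with x | y
        · exact ⟨x, rfl⟩
        · exact absurd h (hno l y)
      obtain ⟨d | j, hx⟩ := hinl' l
      · exact ⟨d, hx⟩
      · obtain ⟨x', hx'⟩ := hinl' (l + 1)
        have h := (hc.1 l).2.2
        rw [hx, hx', plus_opp_inl_inr] at h
        exact absurd (SameCycle.symm h) (G.not_plus_sameVertex_inl_inr _ _)
    choose c' hc' using hinl
    refine hcyc (i - k) n (fun l => Sum.inl (c' l)) ⟨fun l => ⟨?_, ?_, ?_⟩, fun l m hlm => ?_⟩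
    · rw [suspension_opp_inl]
      exact fun h => G.opp_ne _ (Sum.inl_injective h)
    · have h := (hc.1 l).2.1
      rw [hc'] at h
      obtain ⟨j, hj, hji⟩ := Option.map_eq_some_iff.1 h
      rw [hj, ← hji]; simp
    · have h := (hc.1 l).2.2
      rw [hc', hc', plus_opp_inl_inl, plus_sameVertex_inl] at h
      exact h
    · refine hc.2 l m ?_
      rw [hc', hc', plus_sameVertex_inl]
      exact hlm
  have hloop : ∀ j : ZMod 3, ∃ y, G.plus.IsMonoCycle (extendColoring S k o) j
      (fun _ : Fin (0 + 1) => Sum.inr y) := by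
    intro j
    cases o
    · refine ⟨VDart.post (j - k + 1), fun _ => ⟨G.plus_opp_ne _, ?_, G.plus_sameVertex_inr _ _⟩,
        fun l m _ => Subsingleton.elim (α := Fin 1) _ _⟩
      simp [extendColoring]; ring
    · refine ⟨VDart.pre (j - k - 1), fun _ => ⟨G.plus_opp_ne _, ?_, G.plus_sameVertex_inr _ _⟩,
        fun l m _ => Subsingleton.elim (α := Fin 1) _ _⟩
      simp [extendColoring]; ring
  have hmeet : ∀ i j, G.plus.CyclesMeet (extendColoring S k o) i j := by
    intro i j n c hc
    obtain ⟨l, y, hl⟩ := hvertex i n c hc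
    obtain ⟨y', hy'⟩ := hloop j
    exact ⟨0, _, hy', l, 0, by rw [hl]; exact G.plus_sameVertex_inr _ _⟩
  exact ⟨hor, hsch, fun i => ⟨hmeet _ _, hmeet _ _⟩⟩

/-- The extension of a planar Schnyder wood. -/
def extendWood [Finite D] (S : G.PlanarWood) (k : ZMod 3) (o : Bool) : G.ToroidalWood :=
  ⟨extendColoring S.1 k o, extendColoring_isToroidalWood S.2 k o⟩

theorem extendWood_extends [Finite D] (S : G.PlanarWood) (k : ZMod 3) (o : Bool) :
    G.Extends (extendWood S k o) k S := fun _ => rfl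

theorem extendWood_loopsDirected [Finite D] (S : G.PlanarWood) (k : ZMod 3) (o : Bool) :
    G.LoopsDirected (extendWood S k o) o := by
  cases o <;> exact fun i => by simp [extendWood, extendColoring]

/-- The colors of the loops are determined by those of the half-edges and by the direction of the
loops. -/
theorem eq_extendWood [Finite D] {S : G.PlanarWood} {k : ZMod 3} {o : Bool} {T : G.ToroidalWood}
    (h : G.Extends T k S) (ho : G.LoopsDirected T o) : T = extendWood S k o := by
  obtain ⟨l, hl, hsp, hloop⟩ := IsToroidalWood.colors T.2
  have hlk : l = k := by
    have h1 := h (Sum.inr 0)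
    rw [hl, S.2.2.2.1] at h1
    simpa using h1
  subst hlk
  refine Subtype.ext (funext ?_)
  rintro (x | (i | i | i))
  · exact h x
  · exact hsp i
  · cases o
    · exact (ho i).1
    · rcases hloop with h1 | h1
      · exact (h1 i).1
      · exact absurd (h1 i).1 (ho i).1
  · cases o
    · rcases hloop with h1 | h1
      · exact absurd (h1 i).2 (ho i).2
      · exact (h1 i).2
    · exact (ho i).2

theorem exists_loopsDirected [Finite D] (T : G.ToroidalWood) : ∃ o, G.LoopsDirected T o := by
  obtain ⟨k, -, -, h | h⟩ := IsToroidalWood.colors T.2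
  · exact ⟨true, fun i => by simp [h i]⟩
  · exact ⟨false, fun i => by simp [h i]⟩

theorem exists_extends [Finite D] (T : G.ToroidalWood) : ∃ S k, G.Extends T k S := by
  obtain ⟨k, hk, hsp, -⟩ := IsToroidalWood.colors T.2
  refine ⟨⟨_, IsToroidalWood.isPlanarWood T.2 hk hsp⟩, k, fun d => ?_⟩
  simp only [Option.map_map]
  cases T.1 (Sum.inl d) <;> simp

/-- The similarity class of the extensions of a planar Schnyder wood; the extension with shift `0`
and loops directed out of `pre i` is taken to represent it. -/
def extensionClass [Finite D] (S : G.PlanarWood) : Quotient G.similar :=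
  Quotient.mk G.similar (extendWood S 0 true)

theorem extensionClass_eq_iff [Finite D] (S : G.PlanarWood) (T : G.ToroidalWood) :
    extensionClass S = Quotient.mk G.similar T ↔ ∃ k, G.Extends T k S := by
  rw [extensionClass, Quotient.eq]
  refine exists_congr fun k => forall_congr' fun d => ?_
  rw [extendWood_extends S 0 true d, Option.map_map]
  simp [Function.comp_def]

theorem extensionClass_bijective [Finite D] :
    Function.Bijective (extensionClass (G := G)) := by
  constructor
  · intro S S' h
    obtain ⟨k, hk⟩ := (extensionClass_eq_iff S _).1 h
    -- the half-edges fix the shift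
    have hk0 : k = 0 := by
      have h1 := hk (Sum.inr 0)
      rw [extendWood_extends, S.2.2.2.1, S'.2.2.2.1] at h1
      simpa using h1.symm
    refine Subtype.ext (funext fun x => ?_)
    have h1 := hk x
    rw [extendWood_extends, hk0] at h1
    simpa using h1.symm
  · rintro ⟨T⟩
    obtain ⟨S, hS⟩ := exists_extends T
    exact ⟨S, (extensionClass_eq_iff S T).2 hS⟩

end RootedPlanarMap

theorem mainTheorem12 {D : Type*} [Finite D] (G : RootedPlanarMap D) :
    G.plus.IsMapOfGenus 1 ∧
    (∃ Φ : G.PlanarWood ≃ Quotient G.similar,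
      ∀ (S : G.PlanarWood) (T : G.ToroidalWood),
        Φ S = Quotient.mk G.similar T ↔ ∃ k : ZMod 3, G.Extends T k S) ∧
    (∀ (S : G.PlanarWood) (k : ZMod 3) (o : Bool),
      ∃! T : G.ToroidalWood, G.Extends T k S ∧ G.LoopsDirected T o) ∧
    (∀ T : G.ToroidalWood, ∃ o : Bool, G.LoopsDirected T o) := by
  refine ⟨G.plus_isMapOfGenus_one,
    ⟨Equiv.ofBijective _ RootedPlanarMap.extensionClass_bijective,
      RootedPlanarMap.extensionClass_eq_iff⟩,
    fun S k o => ⟨RootedPlanarMap.extendWood S k o,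
      ⟨RootedPlanarMap.extendWood_extends S k o, RootedPlanarMap.extendWood_loopsDirected S k o⟩,
      fun T hT => RootedPlanarMap.eq_extendWood hT.1 hT.2⟩,
    RootedPlanarMap.exists_loopsDirected⟩
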